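/- Let $n\ge 7$ and let $a$ be an integer such that the circulant graph $\Gamma=TL_n(a,a-1,1)=\mathrm{Cay}(\mathbb Z_n,\{\pm[a],\pm[a-1],\pm[1]\})$ is a 6-valent first-kind Frobenius circulant with kernel $\mathbb Z_n$; that is, the six classes $\pm[a],\pm[a-1],\pm[1]$ are distinct and there is a subgroup $H\le\mathrm{Aut}(\mathbb Z_n)$ such that $\mathbb Z_n\rtimes H$ is a Frobenius group on $\mathbb Z_n$ and the connection set is an $H$-orbit generating $\mathbb Z_n$, where $|H|$ is even or the orbit consists of involutions. Let $D$ be the diameter of $\Gamma$. Let $\rho=(1+\sqrt{-3})/2$, and for $0\neq\alpha\in\mathbb Z[\rho]$ let $EJ_\alpha$ be the Cayley graph on the additive group of $\mathbb Z[\rho]/(\alpha)$ with connection set $\{\pm1,\pm\rho,\pm\rho^2\}$ modulo $\alpha$. The Wiener index $W(\Gamma)$ is the sum of the distances over all unordered pairs of vertices. Then: (1) There are coprime integers $c\ge d\ge 0$ with $\Gamma\cong EJ_{c+d\rho}$. For all integers $c\ge d\ge 0$ with $\Gamma\cong EJ_{c+d\rho}$, if $c+d$ is odd, then $$W(\Gamma)=\frac{3n}{2}\Bigl(D(D+1)\bigl[(2c+d)-(2D+1)\bigr]-\tfrac1{12}(2c-d)\bigl[(c+d)^2-1\bigr]\Bigr),$$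 and if $c+d$ is even, then $$W(\Gamma)=\frac{3n}{2}\Bigl(\tfrac12D(D+1)\bigl[(7c+5d)-2(2D+1)\bigr]+\tfrac1{12}(c+d)^2(4c+d-6)+\tfrac16(c+d)\bigl[n-3c+3-6D(2c+d)\bigr]\Bigr).$$ (2) Equivalently, $$W(\Gamma)=\frac{3n}{2}\sum_{j=0}^{r}i_j(i_j+2j+1),$$ where $i_j$ and $r$ are defined as follows. To a pair $(i,j)$ of nonnegative integers attach the set $O(i,j)=\{[(i+ja)a^k]:0\le k\le5\}$. Start with the selected set $Y=\{(1,0)\}$. For $\ell=2,3,\dots$ examine the pairs $(\ell,0),(\ell-1,1),\dots,(1,\ell-1)$ in this order and add $(i,j)$ to $Y$ if $O(i,j)$ is not contained in the union of the sets attached to the pairs selected so far; do not begin a new value of $\ell$ (including $\ell=2$) once all nonzero classes of $\mathbb Z_n$ are covered by that union. For the final $Y$, let $i_j$ be the largest $i\ge1$ with $(i,j)\in Y$, and $i_j=0$ if there is none; let $r=i_0$. -/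

import Mathlib

/-! ### Frobenius groups and first-kind Frobenius Cayley graphs -/

/-- A permutation group `G` on `Ω` is a Frobenius group if it is transitive, not regular, and only
the identity fixes two points. -/
structure IsFrobeniusGroup {Ω : Type*} (G : Subgroup (Equiv.Perm Ω)) : Prop where
  transitive : MulAction.IsPretransitive G Ω
  not_regular : ∃ ω : Ω, MulAction.stabilizer G ω ≠ ⊥
  eq_one_of_fixes_two : ∀ g ∈ G, ∀ x y : Ω, x ≠ y → g x = x → g y = y → g = 1

/-- The semidirect product `K ⋊ H`, for `H ≤ Aut K`, as a permutation group on the (additively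
written, abelian) group `K`: `K` acts by translations and `H` by automorphisms, so the elements are
the maps `x ↦ h x + y` with `h ∈ H` and `y ∈ K`. (The group structure on `AddAut K` is composition,
which Mathlib writes additively.) -/
def semidirectPerm {K : Type*} [AddCommGroup K] (H : AddSubgroup (AddAut K)) :
    Subgroup (Equiv.Perm K) where
  carrier := {g | ∃ h ∈ H, ∃ y : K, ∀ x : K, g x = h x + y}
  one_mem' := ⟨0, H.zero_mem, 0, fun x => by simp⟩
  mul_mem' := by
    rintro f g ⟨h, hh, y, hf⟩ ⟨k, hk, z, hg⟩
    refine ⟨h + k, H.add_mem hh hk, h z + y, fun x => ?_⟩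
    simp [hf, hg, add_assoc]
  inv_mem' := by
    rintro g ⟨h, hh, y, hg⟩
    refine ⟨-h, H.neg_mem hh, -((-h) y), fun x => ?_⟩
    rw [Equiv.Perm.inv_eq_iff_eq, hg, ← sub_eq_add_neg, ← map_sub]
    simp

/-- `S` is the connection set of a first-kind `K ⋊ H`-Frobenius graph on `K` for some `H ≤ Aut K`:
`K ⋊ H` is a Frobenius group, `S` is the `H`-orbit of an element `s`, `S` generates `K`, and either
`|H|` is even or `s` is an involution. -/
def IsFirstKindFrobeniusSet {K : Type*} [AddCommGroup K] (S : Set K) : Prop :=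
  ∃ H : AddSubgroup (AddAut K), IsFrobeniusGroup (semidirectPerm H) ∧
    ∃ s : K, S = {x | ∃ h ∈ H, x = h s} ∧ AddSubgroup.closure S = ⊤ ∧
      (Even (Nat.card H) ∨ addOrderOf s = 2)

/-! ### The circulants `TL_n(a, b, c)` -/

/-- The set `{±[a], ±[b], ±[c]}` of residue classes modulo `n`. -/
def circulantSet (n : ℕ) (a b c : ℤ) : Set (ZMod n) :=
  {(a : ZMod n), -(a : ZMod n), (b : ZMod n), -(b : ZMod n), (c : ZMod n), -(c : ZMod n)}

/-- The circulant graph `TL_n(a, b, c)`. -/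
def circulantTL (n : ℕ) (a b c : ℤ) : SimpleGraph (ZMod n) :=
  SimpleGraph.addCayley (circulantSet n a b c)

/-- `TL_n(a, b, c)` is a 6-valent first-kind Frobenius circulant (with kernel `ℤ/n`). -/
def IsSixValentFrobeniusCirculant (n : ℕ) (a b c : ℤ) : Prop :=
  7 ≤ n ∧ (circulantSet n a b c).ncard = 6 ∧ IsFirstKindFrobeniusSet (circulantSet n a b c)

/-! ### Eisenstein-Jacobi graphs -/

/-- The ring `ℤ[ρ]` with `ρ ^ 2 = ρ - 1`, i.e. `ρ = (1 + √-3) / 2`; `⟨x, y⟩` stands for `x + y ρ`. -/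
abbrev EisensteinJacobi : Type := QuadraticAlgebra ℤ (-1) 1

/-- The element `ρ` of `ℤ[ρ]`. -/
def ejRho : EisensteinJacobi := ⟨0, 1⟩

/-- The quotient ring `ℤ[ρ] / (α)`. -/
abbrev EJQuotient (α : EisensteinJacobi) : Type := EisensteinJacobi ⧸ Ideal.span {α}

/-- The Eisenstein-Jacobi graph `EJ_α`: the Cayley graph on the additive group of `ℤ[ρ] / (α)` with
connection set `{±1, ±ρ, ±ρ²}`. -/
def ejGraph (α : EisensteinJacobi) : SimpleGraph (EJQuotient α) :=
  SimpleGraph.addCayley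
    (Ideal.Quotient.mk (Ideal.span {α}) ''
      ({1, -1, ejRho, -ejRho, ejRho ^ 2, -ejRho ^ 2} : Set EisensteinJacobi))

/-! ### The Wiener index -/

/-- The Wiener index: the sum of the distances over all unordered pairs of vertices (the diagonal
pairs contribute zero). -/
noncomputable def wienerIndex {V : Type*} [Fintype V] [DecidableEq V] (G : SimpleGraph V) : ℕ :=
  ∑ e : Sym2 V, Sym2.lift ⟨fun u v => G.dist u v, fun _ _ => G.dist_comm⟩ e

/-! ### The explicit expressions -/

/-- `D(D+1)[(2c+d) - (2D+1)] - (1/12)(2c-d)[(c+d)² - 1]`. -/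
def oddExpression (c d D : ℚ) : ℚ :=
  D * (D + 1) * ((2 * c + d) - (2 * D + 1)) - 1 / 12 * (2 * c - d) * ((c + d) ^ 2 - 1)

/-- `(1/2)D(D+1)[(7c+5d) - 2(2D+1)] + (1/12)(c+d)²(4c+d-6) + (1/6)(c+d)[n-3c+3-6D(2c+d)]`. -/
def evenExpression (n c d D : ℚ) : ℚ :=
  1 / 2 * D * (D + 1) * ((7 * c + 5 * d) - 2 * (2 * D + 1))
    + 1 / 12 * (c + d) ^ 2 * (4 * c + d - 6)
    + 1 / 6 * (c + d) * (n - 3 * c + 3 - 6 * D * (2 * c + d))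

/-! ### The minimum distance diagram and the parameters `i_j` -/

section Diagram

variable (n : ℕ) [NeZero n] (a : ℤ)

/-- The set `H[i + j a] = {[(i + j a) a^k] : 0 ≤ k ≤ 5}` attached to the cell `(i, j, 0)`, encoded
as the pair `(i, j)`. -/
def cellOrbit (p : ℕ × ℕ) : Finset (ZMod n) :=
  (Finset.range 6).image fun k => ((p.1 : ZMod n) + (p.2 : ZMod n) * (a : ZMod n)) * (a : ZMod n) ^ k

/-- The set of residue classes covered by a set `Y` of cells `(i, j, 0)` and their rotations. -/
def coveredBy (Y : Finset (ℕ × ℕ)) : Finset (ZMod n) := Y.biUnion (cellOrbit n a)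

/-- Examine one cell: select it if its orbit is not already contained in the covered set. -/
def examineCell (Y : Finset (ℕ × ℕ)) (p : ℕ × ℕ) : Finset (ℕ × ℕ) :=
  if cellOrbit n a p ⊆ coveredBy n a Y then Y else insert p Y

/-- The cells `(ℓ, 0), (ℓ - 1, 1), …, (1, ℓ - 1)` of level `ℓ`, in this order. -/
def levelCells (ℓ : ℕ) : List (ℕ × ℕ) := (List.range ℓ).map fun j => (ℓ - j, j)

/-- The selected cells after `m` rounds. One starts with the cell `(1, 0)`; in each round the cells of
the next level `ℓ = m + 2` (so `ℓ = 2, 3, …`) are examined one by one, unless all nonzero residue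
classes are already covered, in which case the procedure has stopped. -/
def diagramStage : ℕ → Finset (ℕ × ℕ)
  | 0 => {(1, 0)}
  | m + 1 =>
    if ∀ u : ZMod n, u ≠ 0 → u ∈ coveredBy n a (diagramStage m) then diagramStage m
    else (levelCells (m + 2)).foldl (examineCell n a) (diagramStage m)

/-- The cells `(i, j)`, `i ≥ 1`, selected when the procedure has stopped. -/
def diagram : Set (ℕ × ℕ) := {p | ∃ m, p ∈ diagramStage n a m}

/-- `i_j`, the largest `i ≥ 0` such that the cell `(i, j, 0)` belongs to the diagram, for
`0 ≤ j ≤ r`. The boundary cell `(0, j, 0)`, being the rotation `(j, 0, 1)` of `(j, 0, 0)`, belongs to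
the diagram for each `1 ≤ j ≤ r`, so that `i = 0` is always admitted. -/
noncomputable def diagramIndex (j : ℕ) : ℕ := sSup {i | i = 0 ∨ (i, j) ∈ diagram n a}

/-- `∑_{j=0}^{r} i_j (i_j + 2 j + 1)`, where `r = i_0` is the largest `i` with `(i, 0, 0)` in the
diagram. -/
noncomputable def diagramExpression : ℕ :=
  ∑ j ∈ Finset.range (diagramIndex n a 0 + 1),
    diagramIndex n a j * (diagramIndex n a j + 2 * j + 1)

end Diagram

/-! A Frobenius complement whose orbit `S` contains 1 acts on `ZMod n` by multiplication by the
elements of `S`. Hence `S` is closed under products, and no element of `S` other than 1 fixes a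
nonzero residue. This forces `a² = a - 1` and `3 ∤ n`, and makes every orbit of `a` on nonzero
residues have six elements (`IsSixValentFrobeniusCirculant.sq_eq`). So `ρ ↦ a` is a surjective ring
homomorphism `ℤ[ρ] → ZMod n` carrying the six units onto the connection set. Distance from 0 becomes
the least `hexNorm` in a coset of the kernel (`hexLen`), and translation invariance gives `2W = n ∑
hexLen`. An element of least norm generates the kernel; rotating it, and conjugating if necessary,
yields `c + dρ` with `d ≤ c`.

For the closed formulas put `α = c + dρ`. Nonzero multiples of `α` have norm at least `c + d`, so a
ball of radius `s` with `2s < c + d` embeds in the quotient and has `3s² + 3s + 1` points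
(`card_hexLen_le`). For larger `s` the points farther than `s` from 0 form two opposite triangles
around the centres of the triangles spanned by the lattice `(α)`, with `k(k+1)` points together, `k
= 2c + d - 3s - 2` (`card_lt_hexLen`). Since `3 ∤ n` gives `3 ∤ 2c + d`, the diameter is `⌊(2c +
d)/3⌋`. Summing the counts over `s < D` telescopes, and the parity of `c + d` decides where one
count takes over from the other.

For the diagram, the greedy procedure selects exactly one cell `(i, j)` at distance `i + j` from
each orbit of `a` on nonzero residues (`mem_diagram`). For each `j` the selected `i` fill the
interval from 1 to `i_j` (`IsCell.pred`, `isCell_iff`). Each cell stands for six residues at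
distance `i + j`, whence the sum. -/

/-! ### The hexagonal norm -/

/-- The length of `z` with respect to the generators `±1, ±ρ, ±ρ²` of `ℤ[ρ]`. -/
def hexNorm (z : EisensteinJacobi) : ℕ :=
  max z.re.natAbs (max z.im.natAbs (z.re + z.im).natAbs)

theorem hexNorm_mk (x y : ℤ) :
    hexNorm ⟨x, y⟩ = max x.natAbs (max y.natAbs (x + y).natAbs) := rfl

theorem hexNorm_natCast_mk (i j : ℕ) : hexNorm ⟨i, j⟩ = i + j := by
  rw [hexNorm_mk]; omega

@[simp] theorem hexNorm_zero : hexNorm 0 = 0 := rfl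

theorem hexNorm_le_iff {z : EisensteinJacobi} {k : ℕ} :
    hexNorm z ≤ k ↔ (-k ≤ z.re ∧ z.re ≤ k) ∧ (-k ≤ z.im ∧ z.im ≤ k) ∧
      (-k ≤ z.re + z.im ∧ z.re + z.im ≤ k) := by
  rw [hexNorm, max_le_iff, max_le_iff]; omega

theorem hexNorm_add_le (z w : EisensteinJacobi) : hexNorm (z + w) ≤ hexNorm z + hexNorm w := by
  have hz := hexNorm_le_iff.1 (le_refl (hexNorm z))
  have hw := hexNorm_le_iff.1 (le_refl (hexNorm w))
  rw [hexNorm_le_iff, QuadraticAlgebra.re_add, QuadraticAlgebra.im_add]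
  push_cast
  omega

theorem hexNorm_sub_le (z w : EisensteinJacobi) : hexNorm (z - w) ≤ hexNorm z + hexNorm w := by
  have hz := hexNorm_le_iff.1 (le_refl (hexNorm z))
  have hw := hexNorm_le_iff.1 (le_refl (hexNorm w))
  rw [hexNorm_le_iff, QuadraticAlgebra.re_sub, QuadraticAlgebra.im_sub]
  push_cast
  omega

theorem hexNorm_eq_zero {z : EisensteinJacobi} (h : hexNorm z = 0) : z = 0 := by
  simp only [hexNorm] at h
  ext
  · rw [QuadraticAlgebra.re_zero]; omega
  · rw [QuadraticAlgebra.im_zero]; omega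

theorem ejRho_mul (x y : ℤ) :
    ejRho * (⟨x, y⟩ : EisensteinJacobi) = ⟨-y, x + y⟩ := by
  ext <;> simp [ejRho]

theorem hexNorm_ejRho_mul (z : EisensteinJacobi) : hexNorm (ejRho * z) = hexNorm z := by
  obtain ⟨x, y⟩ := z
  rw [ejRho_mul, hexNorm_mk, hexNorm_mk]; omega

theorem hexNorm_ejRho_pow_mul (k : ℕ) (z : EisensteinJacobi) :
    hexNorm (ejRho ^ k * z) = hexNorm z := by
  induction k with
  | zero => simp
  | succ k ih => rw [pow_succ', mul_assoc, hexNorm_ejRho_mul, ih]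

theorem ejRho_mul_self : ejRho * ejRho = ejRho - 1 := by
  ext <;> simp [ejRho, QuadraticAlgebra.re_one, QuadraticAlgebra.im_one]

theorem ejRho_sq : ejRho ^ 2 = ejRho - 1 := by rw [sq, ejRho_mul_self]

theorem ejRho_cube : ejRho ^ 3 = -1 := by
  linear_combination (ejRho + 1) * ejRho_sq

theorem ejRho_pow_six : ejRho ^ 6 = 1 := by
  linear_combination (ejRho ^ 3 - 1) * ejRho_cube

theorem ejRho_sq_mul (x y : ℤ) :
    ejRho ^ 2 * (⟨x, y⟩ : EisensteinJacobi) = ⟨-x - y, x⟩ := by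
  rw [sq, mul_assoc, ejRho_mul, ejRho_mul]; ext <;> simp; ring

theorem ejRho_cube_mul (x y : ℤ) :
    ejRho ^ 3 * (⟨x, y⟩ : EisensteinJacobi) = ⟨-x, -y⟩ := by
  rw [ejRho_cube]; ext <;> simp

theorem ejRho_pow_four_mul (x y : ℤ) :
    ejRho ^ 4 * (⟨x, y⟩ : EisensteinJacobi) = ⟨y, -x - y⟩ := by
  rw [pow_succ', mul_assoc, ejRho_cube_mul, ejRho_mul]; ext <;> simp; ring

theorem ejRho_pow_five_mul (x y : ℤ) :
    ejRho ^ 5 * (⟨x, y⟩ : EisensteinJacobi) = ⟨x + y, -x⟩ := by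
  rw [pow_succ', mul_assoc, ejRho_pow_four_mul, ejRho_mul]; ext <;> simp; ring

theorem mk_eq_add_mul_ejRho (x y : ℤ) :
    (⟨x, y⟩ : EisensteinJacobi) = (x : EisensteinJacobi) + (y : EisensteinJacobi) * ejRho := by
  ext <;> simp [ejRho]

/-- Every nonzero element is a rotation of an element of the sextant `x ≥ 1`, `y ≥ 0`. -/
theorem exists_sextant {z : EisensteinJacobi} (hz : z ≠ 0) :
    ∃ k < 6, ∃ i j : ℕ, 1 ≤ i ∧ z = ejRho ^ k * ⟨i, j⟩ := by
  obtain ⟨u, v⟩ := z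
  have key : ∀ k < 6, ∀ i j : ℤ, 1 ≤ i → 0 ≤ j →
      (⟨u, v⟩ : EisensteinJacobi) = ejRho ^ k * ⟨i, j⟩ →
      ∃ k < 6, ∃ i j : ℕ, 1 ≤ i ∧
        (⟨u, v⟩ : EisensteinJacobi) = ejRho ^ k * ⟨i, j⟩ := by
    intro k hk i j hi hj h
    lift i to ℕ using by omega
    lift j to ℕ using hj
    exact ⟨k, hk, i, j, by omega, h⟩
  have hne : u ≠ 0 ∨ v ≠ 0 := by
    by_contra! h
    exact hz (by rw [h.1, h.2]; rfl)
  rcases (by omega : (1 ≤ u ∧ 0 ≤ v) ∨ (0 ≤ -u ∧ 1 ≤ u + v) ∨ (1 ≤ v ∧ 0 ≤ -u - v) ∨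
    (1 ≤ -u ∧ 0 ≤ -v) ∨ (1 ≤ -u - v ∧ 0 ≤ u) ∨ (1 ≤ -v ∧ 0 ≤ u + v)) with
    h | h | h | h | h | h
  · exact key 0 (by norm_num) u v h.1 h.2 (by simp)
  · exact key 1 (by norm_num) (u + v) (-u) h.2 h.1 (by rw [pow_one, ejRho_mul]; ext <;> simp)
  · exact key 2 (by norm_num) v (-u - v) h.1 h.2 (by rw [ejRho_sq_mul]; ext <;> simp; ring)
  · exact key 3 (by norm_num) (-u) (-v) h.1 h.2 (by rw [ejRho_cube_mul]; ext <;> simp)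
  · exact key 4 (by norm_num) (-u - v) u h.1 h.2 (by rw [ejRho_pow_four_mul]; ext <;> simp)
  · exact key 5 (by norm_num) (-v) (u + v) h.1 h.2 (by rw [ejRho_pow_five_mul]; ext <;> simp)

/-- An element at least as long as `w ≠ 0` can be shortened modulo `w`. -/
theorem exists_hexNorm_sub_mul_lt {w z : EisensteinJacobi} (hw : w ≠ 0)
    (h : hexNorm w ≤ hexNorm z) : ∃ q, hexNorm (z - w * q) < hexNorm z := by
  obtain ⟨k, hk, i, j, hi, rfl⟩ := exists_sextant hw
  have hz : z ≠ 0 := by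
    rintro rfl
    rw [hexNorm_ejRho_pow_mul, hexNorm_natCast_mk, hexNorm_zero] at h
    omega
  obtain ⟨l, hl, p, q, hp, rfl⟩ := exists_sextant hz
  rw [hexNorm_ejRho_pow_mul, hexNorm_ejRho_pow_mul, hexNorm_natCast_mk, hexNorm_natCast_mk] at h
  have hk6 : ejRho ^ k * ejRho ^ (6 - k) = 1 := by
    rw [← pow_add, show k + (6 - k) = 6 by omega, ejRho_pow_six]
  -- This unit is `ρ^(l-k)`: it turns `w` into the sextant of `z`, where subtracting it shortens
  -- `z`.
  refine ⟨ejRho ^ (6 - k) * ejRho ^ l, ?_⟩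
  rw [show ejRho ^ l * ⟨p, q⟩ - ejRho ^ k * ⟨i, j⟩ * (ejRho ^ (6 - k) * ejRho ^ l) =
    ejRho ^ l * ((⟨p, q⟩ : EisensteinJacobi) - ⟨i, j⟩) by
      linear_combination (-(ejRho ^ l * (⟨i, j⟩ : EisensteinJacobi))) * hk6,
    hexNorm_ejRho_pow_mul, hexNorm_ejRho_pow_mul, hexNorm_natCast_mk, QuadraticAlgebra.mk_sub_mk,
    hexNorm_mk]
  omega

/-- A nonzero element of norm at most `k + 1` is within one step of norm at most `k`. -/
theorem exists_step {z : EisensteinJacobi} {k : ℕ} (hz : hexNorm z ≤ k + 1) :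
    hexNorm z ≤ k ∨ ∃ m < 6, hexNorm (z - ejRho ^ m) ≤ k := by
  by_cases h0 : z = 0
  · left; simp [h0]
  obtain ⟨m, hm, i, j, hi, rfl⟩ := exists_sextant h0
  right
  refine ⟨m, hm, ?_⟩
  rw [show ejRho ^ m * ⟨i, j⟩ - ejRho ^ m =
    ejRho ^ m * ((⟨i, j⟩ : EisensteinJacobi) - ⟨1, 0⟩) by
      rw [mul_sub]; congr 1; exact (mul_one _).symm]
  rw [hexNorm_ejRho_pow_mul, hexNorm_natCast_mk] at hz
  rw [hexNorm_ejRho_pow_mul, QuadraticAlgebra.mk_sub_mk, hexNorm_mk]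
  omega

/-- The six units `±1, ±ρ, ±ρ²`. -/
def ejUnits : Set EisensteinJacobi := {1, -1, ejRho, -ejRho, ejRho ^ 2, -ejRho ^ 2}

theorem mem_ejUnits_iff {z : EisensteinJacobi} : z ∈ ejUnits ↔ ∃ k < 6, z = ejRho ^ k := by
  have h4 : ejRho ^ 4 = -ejRho := by rw [pow_succ', ejRho_cube]; ring
  have h5 : ejRho ^ 5 = -ejRho ^ 2 := by linear_combination ejRho ^ 2 * ejRho_cube
  constructor
  · rintro (rfl | rfl | rfl | rfl | rfl | rfl)
    · exact ⟨0, by norm_num, by simp⟩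
    · exact ⟨3, by norm_num, ejRho_cube.symm⟩
    · exact ⟨1, by norm_num, by simp⟩
    · exact ⟨4, by norm_num, h4.symm⟩
    · exact ⟨2, by norm_num, rfl⟩
    · exact ⟨5, by norm_num, h5.symm⟩
  · rintro ⟨k, hk, rfl⟩
    interval_cases k <;> simp [ejUnits, ejRho_cube, h4, h5]

theorem hexNorm_ejRho_pow (k : ℕ) : hexNorm (ejRho ^ k) = 1 := by
  rw [← mul_one (ejRho ^ k), hexNorm_ejRho_pow_mul]; rfl

/-! ### Cayley graphs of quotients of `ℤ[ρ]` -/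

section HexGraph

variable {A : Type*} [CommRing A] (f : EisensteinJacobi →+* A)

/-- The Cayley graph of the ring `A` with respect to the images of the units of `ℤ[ρ]`. -/
def hexGraph : SimpleGraph A := SimpleGraph.addCayley (f '' ejUnits)

variable {f}

theorem hexGraph_adj_iff {u v : A} :
    (hexGraph f).Adj u v ↔ u ≠ v ∧ ∃ k < 6, v - u = f (ejRho ^ k) := by
  rw [hexGraph, SimpleGraph.addCayley_adj, and_congr_right_iff]
  intro _
  constructor
  · rintro (⟨z, hz, h⟩ | ⟨z, hz, h⟩) <;> obtain ⟨k, hk, rfl⟩ := mem_ejUnits_iff.1 hz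
    · exact ⟨k, hk, by rw [h]; ring⟩
    · have hz' : -ejRho ^ k ∈ ejUnits := by
        rcases hz with h | h | h | h | h | h <;> rw [h] <;> simp [ejUnits]
      obtain ⟨m, hm, h'⟩ := mem_ejUnits_iff.1 hz'
      exact ⟨m, hm, by rw [← h', map_neg, h]; ring⟩
  · rintro ⟨k, hk, h⟩
    left
    exact ⟨ejRho ^ k, mem_ejUnits_iff.2 ⟨k, hk, rfl⟩, by rw [← h]; ring⟩

theorem exists_of_walk {u v : A} (p : (hexGraph f).Walk u v) :
    ∃ z, hexNorm z ≤ p.length ∧ f z = v - u := by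
  induction p with
  | nil => exact ⟨0, by simp, by simp⟩
  | cons h p ih =>
    obtain ⟨z, hz, h1⟩ := ih
    obtain ⟨k, -, h2⟩ := (hexGraph_adj_iff.1 h).2
    refine ⟨z + ejRho ^ k, ?_, ?_⟩
    · have := hexNorm_add_le z (ejRho ^ k)
      rw [hexNorm_ejRho_pow] at this
      rw [SimpleGraph.Walk.length_cons]
      omega
    · rw [map_add, h1, ← h2]; ring

theorem exists_walk_of_hexNorm_le (k : ℕ) :
    ∀ (z : EisensteinJacobi), hexNorm z ≤ k → ∀ u v : A, f z = v - u →
      ∃ p : (hexGraph f).Walk u v, p.length ≤ k := by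
  induction k with
  | zero =>
    intro z hz u v h
    rw [hexNorm_eq_zero (Nat.le_zero.1 hz), map_zero] at h
    obtain rfl := sub_eq_zero.1 h.symm
    exact ⟨.nil, le_rfl⟩
  | succ k ih =>
    intro z hz u v h
    rcases exists_step hz with h1 | ⟨m, hm, h1⟩
    · obtain ⟨p, hp⟩ := ih z h1 u v h
      exact ⟨p, by omega⟩
    · obtain ⟨p, hp⟩ := ih _ h1 (u + f (ejRho ^ m)) v (by rw [map_sub, h]; ring)
      -- A unit may map to 0 in `A`; such a step is no edge and is dropped.
      by_cases hne : u = u + f (ejRho ^ m)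
      · exact ⟨p.copy hne.symm rfl, by rw [SimpleGraph.Walk.length_copy]; omega⟩
      · exact ⟨.cons (hexGraph_adj_iff.2 ⟨hne, m, hm, by ring⟩) p, by
          rw [SimpleGraph.Walk.length_cons]; omega⟩

theorem hexGraph_connected (hf : Function.Surjective f) : (hexGraph f).Connected := by
  refine ⟨fun u v => ?_⟩
  obtain ⟨z, hz⟩ := hf (v - u)
  obtain ⟨p, -⟩ := exists_walk_of_hexNorm_le _ z le_rfl u v hz
  exact ⟨p⟩

/-- Walks lift to sums of units and conversely, so graph distances reduce to norms of
representatives. -/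
theorem hexGraph_dist_le_iff (hf : Function.Surjective f) {u v : A} {k : ℕ} :
    (hexGraph f).dist u v ≤ k ↔ ∃ z, hexNorm z ≤ k ∧ f z = v - u := by
  constructor
  · intro h
    obtain ⟨p, hp⟩ := (hexGraph_connected hf).exists_walk_length_eq_dist u v
    obtain ⟨z, hz, h1⟩ := exists_of_walk p
    exact ⟨z, by omega, h1⟩
  · rintro ⟨z, hz, h1⟩
    obtain ⟨p, hp⟩ := exists_walk_of_hexNorm_le k z hz u v h1
    exact (SimpleGraph.dist_le p).trans hp

variable (f) in
/-- The distance of `v` from `0`. -/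
noncomputable def hexLen (v : A) : ℕ := (hexGraph f).dist 0 v

theorem hexLen_le_iff (hf : Function.Surjective f) {v : A} {k : ℕ} :
    hexLen f v ≤ k ↔ ∃ z, hexNorm z ≤ k ∧ f z = v := by
  rw [hexLen, hexGraph_dist_le_iff hf, sub_zero]

theorem hexGraph_dist_eq (hf : Function.Surjective f) (u v : A) :
    (hexGraph f).dist u v = hexLen f (v - u) := by
  refine eq_of_forall_ge_iff fun k => ?_
  rw [hexLen_le_iff hf, hexGraph_dist_le_iff hf]

theorem hexLen_map_le (hf : Function.Surjective f) (z : EisensteinJacobi) :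
    hexLen f (f z) ≤ hexNorm z := (hexLen_le_iff hf).2 ⟨z, le_rfl, rfl⟩

theorem exists_hexNorm_eq_hexLen (hf : Function.Surjective f) (v : A) :
    ∃ z, hexNorm z = hexLen f v ∧ f z = v := by
  obtain ⟨z, hz, rfl⟩ := (hexLen_le_iff hf (v := v)).1 le_rfl
  exact ⟨z, le_antisymm hz (hexLen_map_le hf z), rfl⟩

@[simp] theorem hexLen_zero : hexLen f 0 = 0 := by simp [hexLen]

theorem hexLen_eq_zero (hf : Function.Surjective f) {v : A} (h : hexLen f v = 0) : v = 0 := by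
  obtain ⟨z, hz, rfl⟩ := exists_hexNorm_eq_hexLen hf v
  rw [hexNorm_eq_zero (hz.trans h), map_zero]

theorem hexLen_add_le (hf : Function.Surjective f) (u v : A) :
    hexLen f (u + v) ≤ hexLen f u + hexLen f v := by
  obtain ⟨z, hz, rfl⟩ := exists_hexNorm_eq_hexLen hf u
  obtain ⟨w, hw, rfl⟩ := exists_hexNorm_eq_hexLen hf v
  rw [← hz, ← hw, ← map_add]
  exact (hexLen_map_le hf _).trans (hexNorm_add_le z w)

theorem hexLen_pow_mul (hf : Function.Surjective f) (k : ℕ) (v : A) :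
    hexLen f (f ejRho ^ k * v) = hexLen f v := by
  have le : ∀ (k : ℕ) (v : A), hexLen f (f ejRho ^ k * v) ≤ hexLen f v := by
    intro k v
    obtain ⟨z, hz, rfl⟩ := exists_hexNorm_eq_hexLen hf v
    rw [← hz, ← map_pow, ← map_mul, ← hexNorm_ejRho_pow_mul k z]
    exact hexLen_map_le hf _
  refine le_antisymm (le k v) ?_
  have h := le (5 * k) (f ejRho ^ k * v)
  rwa [← mul_assoc, ← pow_add, show 5 * k + k = 6 * k by ring, pow_mul, ← map_pow f ejRho 6,
    ejRho_pow_six, map_one, one_pow, one_mul] at h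

end HexGraph

/-! ### Wiener index and diameter -/

theorem two_mul_wienerIndex {V : Type*} [Fintype V] [DecidableEq V] (G : SimpleGraph V) :
    2 * wienerIndex G = ∑ u : V, ∑ v : V, G.dist u v := by
  have h1 : ∑ u : V, ∑ v : V, G.dist u v =
      ∑ p : V × V, Sym2.lift ⟨fun u v => G.dist u v, fun _ _ => G.dist_comm⟩ s(p.1, p.2) := by
    rw [Fintype.sum_prod_type]
    simp
  rw [h1, wienerIndex, ← Finset.sum_fiberwise (s := Finset.univ)
    (g := fun p : V × V => s(p.1, p.2)), Finset.mul_sum]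
  refine Finset.sum_congr rfl fun e _ => ?_
  induction e with
  | _ x y =>
    rw [Finset.sum_congr rfl (g := fun _ => G.dist x y)]
    · rw [Finset.sum_const, smul_eq_mul, Sym2.lift_mk]
      -- An unordered pair off the diagonal has two orderings; a diagonal pair has one, but
      -- contributes distance 0.
      by_cases hxy : x = y
      · simp [hxy]
      · congr 1
        rw [show (Finset.univ.filter fun p : V × V => s(p.1, p.2) = s(x, y)) =
          {(x, y), (y, x)} by ext ⟨p, q⟩; simp]
        rw [Finset.card_pair (by simp [hxy])]
    · intro p hp
      rw [(Finset.mem_filter.1 hp).2, Sym2.lift_mk]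

theorem two_mul_wienerIndex_hexGraph {A : Type*} [CommRing A] [Fintype A] [DecidableEq A]
    {f : EisensteinJacobi →+* A} (hf : Function.Surjective f) :
    2 * wienerIndex (hexGraph f) = Fintype.card A * ∑ v : A, hexLen f v := by
  rw [two_mul_wienerIndex, Finset.sum_congr rfl (g := fun _ => ∑ v : A, hexLen f v)]
  · rw [Finset.sum_const, Finset.card_univ, smul_eq_mul]
  · intro u _
    simp_rw [hexGraph_dist_eq hf]
    exact (Equiv.subRight u).sum_comp (fun v => hexLen f v)

theorem SimpleGraph.Connected.dist_hom_le {V W : Type*} {G : SimpleGraph V} {H : SimpleGraph W}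
    (hG : G.Connected) (e : G →g H) (u v : V) : H.dist (e u) (e v) ≤ G.dist u v := by
  obtain ⟨p, hp⟩ := hG.exists_walk_length_eq_dist u v
  rw [← hp, ← p.length_map e]
  exact SimpleGraph.dist_le _

theorem SimpleGraph.Connected.dist_iso_eq {V W : Type*} {G : SimpleGraph V} {H : SimpleGraph W}
    (hG : G.Connected) (e : G ≃g H) (u v : V) : H.dist (e u) (e v) = G.dist u v := by
  refine le_antisymm (hG.dist_hom_le e.toHom u v) ?_
  have h := (e.connected_iff.1 hG).dist_hom_le e.symm.toHom (e u) (e v)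
  simpa using h

theorem SimpleGraph.Connected.diam_eq {V : Type*} [Finite V] {G : SimpleGraph V}
    (hG : G.Connected) {D : ℕ} (h : ∀ u v, G.dist u v ≤ D) {x y : V} (hD : G.dist x y = D) :
    G.diam = D := by
  have := hG.nonempty
  obtain ⟨u, v, huv⟩ := G.exists_dist_eq_diam
  refine le_antisymm (huv ▸ h u v) (hD ▸ SimpleGraph.dist_le_diam ?_)
  exact SimpleGraph.connected_iff_ediam_ne_top.1 hG

/-! ### The distance distribution modulo `c + dρ` -/

/-- The pairs `(p, q)` with `p + q < k`. -/
def triangle (k : ℕ) : Finset (Σ _ : ℕ, ℕ) := (Finset.range k).sigma fun p => Finset.range (k - p)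

theorem mem_triangle {k : ℕ} {x : Σ _ : ℕ, ℕ} : x ∈ triangle k ↔ x.1 + x.2 < k := by
  simp only [triangle, Finset.mem_sigma, Finset.mem_range]; omega

theorem two_mul_sum_range_sub (N k : ℕ) (h : k ≤ N + 1) :
    2 * ((∑ p ∈ Finset.range k, (N - p) : ℕ) : ℤ) = k * (2 * N - k + 1) := by
  induction k with
  | zero => simp
  | succ k ih =>
    rw [Finset.sum_range_succ]
    push_cast [Nat.sub_add_cancel, show k ≤ N by omega]
    have := ih (by omega)
    push_cast at this
    linear_combination this

theorem two_mul_card_triangle (k : ℕ) : 2 * ((triangle k).card : ℤ) = k * (k + 1) := by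
  rw [triangle, Finset.card_sigma]
  simp_rw [Finset.card_range]
  rw [two_mul_sum_range_sub k k (by omega)]
  ring

/-- The elements of `ℤ[ρ]` of norm at most `s`. -/
def hexBall (s : ℕ) : Finset EisensteinJacobi :=
  (((Finset.range (s + 1)).sigma fun x => Finset.range (2 * s + 1 - x)).image
      fun p => (⟨p.1, p.2 - s⟩ : EisensteinJacobi)) ∪
    (((Finset.range s).sigma fun x => Finset.range (2 * s - x)).image
      fun p => (⟨-(p.1 + 1), s - p.2⟩ : EisensteinJacobi))

theorem mem_hexBall {s : ℕ} {z : EisensteinJacobi} : z ∈ hexBall s ↔ hexNorm z ≤ s := by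
  rw [hexNorm_le_iff]
  obtain ⟨x, y⟩ := z
  simp only [hexBall, Finset.mem_union, Finset.mem_image, Finset.mem_sigma, Finset.mem_range,
    Sigma.exists, QuadraticAlgebra.mk.injEq]
  constructor
  · rintro (⟨p, q, h, rfl, rfl⟩ | ⟨p, q, h, rfl, rfl⟩) <;> omega
  · intro h
    by_cases hx : 0 ≤ x
    · exact Or.inl ⟨x.toNat, (y + s).toNat, by omega, by omega, by omega⟩
    · exact Or.inr ⟨(-x - 1).toNat, (s - y).toNat, by omega, by omega, by omega⟩

theorem card_hexBall (s : ℕ) : (hexBall s).card = 3 * s ^ 2 + 3 * s + 1 := by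
  rw [hexBall, Finset.card_union_of_disjoint, Finset.card_image_of_injOn,
    Finset.card_image_of_injOn, Finset.card_sigma, Finset.card_sigma]
  · simp_rw [Finset.card_range]
    have h1 := two_mul_sum_range_sub (2 * s + 1) (s + 1) (by omega)
    have h2 := two_mul_sum_range_sub (2 * s) s (by omega)
    have h3 : (2 : ℤ) * ((∑ p ∈ Finset.range (s + 1), (2 * s + 1 - p) : ℕ) +
      (∑ p ∈ Finset.range s, (2 * s - p) : ℕ)) = 2 * (3 * s ^ 2 + 3 * s + 1) := by
      rw [mul_add, h1, h2]; push_cast; ring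
    have h4 := mul_left_cancel₀ (by norm_num) h3
    exact_mod_cast h4
  · rintro ⟨p, q⟩ - ⟨p', q'⟩ - h
    simp only [QuadraticAlgebra.mk.injEq] at h
    obtain ⟨h1, h2⟩ := h
    obtain rfl : p = p' := by omega
    obtain rfl : q = q' := by omega
    rfl
  · rintro ⟨p, q⟩ - ⟨p', q'⟩ - h
    simp only [QuadraticAlgebra.mk.injEq] at h
    obtain ⟨h1, h2⟩ := h
    obtain rfl : p = p' := by omega
    obtain rfl : q = q' := by omega
    rfl
  · rw [Finset.disjoint_left]
    rintro z h1 h2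
    obtain ⟨p, -, rfl⟩ := Finset.mem_image.1 h1
    obtain ⟨q, -, h⟩ := Finset.mem_image.1 h2
    simp only [QuadraticAlgebra.mk.injEq] at h
    omega

theorem le_hexNorm_mul_rotate (c d p q k : ℕ) :
    (c + d) * p + c * q ≤
      hexNorm ((⟨c, d⟩ : EisensteinJacobi) * (ejRho ^ k * ⟨p, q⟩)) := by
  -- The sum of the two coordinates of `(c + dρ)(p + qρ)` is `(c + d)p + cq`, and the norm dominates
  -- it.
  rw [mul_left_comm, hexNorm_ejRho_pow_mul, QuadraticAlgebra.mk_mul_mk, hexNorm_mk]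
  refine le_trans ?_ ((le_max_right _ _).trans (le_max_right _ _))
  zify
  refine le_trans (le_of_eq ?_) (le_abs_self _)
  ring

/-- Nonzero multiples of `c + dρ` have norm at least `c + d`. -/
theorem le_hexNorm_mul (c d : ℕ) {q : EisensteinJacobi} (hq : q ≠ 0) :
    c + d ≤ hexNorm ((⟨c, d⟩ : EisensteinJacobi) * q) := by
  obtain ⟨k, -, i, j, hi, rfl⟩ := exists_sextant hq
  refine le_trans ?_ (le_hexNorm_mul_rotate c d i j k)
  nlinarith [Nat.mul_le_mul (le_refl (c + d)) hi]

/-- The triangle of points at distance more than `s` from `0`, `c + dρ` and `(c + dρ)ρ`. -/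
def IsFar (c d s : ℕ) (z : EisensteinJacobi) : Prop :=
  s + 1 ≤ z.re + z.im ∧ z.re + s + 1 ≤ c ∧ z.im + s + 1 ≤ c + d

/-- This map is the rotation of order three permuting the vertices `0`, `α`, `αρ` with `α = c + dρ`.
Modulo `α` it is multiplication by `ρ²`. -/
theorem IsFar.rotate {c d s : ℕ} {z : EisensteinJacobi} (h : IsFar c d s z) :
    IsFar c d s (ejRho ^ 2 * z + ⟨c, d⟩) := by
  obtain ⟨x, y⟩ := z
  rw [ejRho_sq_mul]
  unfold IsFar at *
  simp only [QuadraticAlgebra.re_add, QuadraticAlgebra.im_add] at *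
  omega

/-- The point of the far triangle with the given coordinates. -/
def farPoint (c d s : ℕ) (x : Σ _ : ℕ, ℕ) : EisensteinJacobi :=
  ⟨c - s - 1 - x.1, c + d - s - 1 - x.2⟩

section Distribution

variable {A : Type*} [CommRing A] {f : EisensteinJacobi →+* A} (hf : Function.Surjective f)
  {c d : ℕ} (hdc : d ≤ c) (hc : 1 ≤ c)
  (hker : ∀ z, f z = 0 ↔ (⟨c, d⟩ : EisensteinJacobi) ∣ z)

include hker in
theorem eq_zero_of_hexNorm_lt {z : EisensteinJacobi} (hz : f z = 0) (h : hexNorm z < c + d) :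
    z = 0 := by
  obtain ⟨q, rfl⟩ := (hker z).1 hz
  by_contra! h0
  have := le_hexNorm_mul c d (q := q) (by rintro rfl; simp at h0)
  omega

-- Two points of the ball differ by norm at most `2s < c + d`, too short for a nonzero multiple of
-- `c + dρ`.
include hf hker in
theorem card_hexLen_le [Fintype A] {s : ℕ} (hs : 2 * s + 1 ≤ c + d) :
    (Finset.univ.filter fun v => hexLen f v ≤ s).card = 3 * s ^ 2 + 3 * s + 1 := by
  classical
  rw [← card_hexBall s, ← Finset.card_image_of_injOn (s := hexBall s) (f := f)]
  · congr 1
    ext v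
    simp only [Finset.mem_filter, Finset.mem_univ, true_and, Finset.mem_image, mem_hexBall]
    rw [hexLen_le_iff hf]
  · intro z hz w hw h
    rw [Finset.mem_coe, mem_hexBall] at hz hw
    have := hexNorm_sub_le z w
    refine sub_eq_zero.1 (eq_zero_of_hexNorm_lt hker (by rw [map_sub, h, sub_self]) ?_)
    omega

include hker in
theorem map_base_eq_zero : f ⟨c, d⟩ = 0 := (hker _).2 dvd_rfl

include hf hdc hc hker in
theorem exists_isFar {s : ℕ} (hs : c + d ≤ 2 * s + 1) {v : A} (hv : s < hexLen f v) :
    ∃ z, IsFar c d s z ∧ (f z = v ∨ f (-z) = v) := by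
  obtain ⟨z, hz, rfl⟩ := exists_hexNorm_eq_hexLen hf v
  have h0 : z ≠ 0 := by rintro rfl; simp at hv
  obtain ⟨k, hk, i, j, hi, rfl⟩ := exists_sextant h0
  have hα := map_base_eq_zero hker
  rw [hexNorm_ejRho_pow_mul, hexNorm_natCast_mk, map_mul, map_pow, hexLen_pow_mul hf] at hz
  rw [map_mul, map_pow, hexLen_pow_mul hf] at hv
  have h1 := hexLen_map_le hf (⟨i, j⟩ - ⟨c, d⟩)
  have h2 := hexLen_map_le hf (⟨i, j⟩ - ejRho * ⟨c, d⟩)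
  rw [map_sub, hα, sub_zero, ← hz, QuadraticAlgebra.mk_sub_mk, hexNorm_mk] at h1
  rw [map_sub, map_mul, hα, mul_zero, sub_zero, ← hz, ejRho_mul, QuadraticAlgebra.mk_sub_mk,
    hexNorm_mk] at h2
  -- A shortest representative cannot be shortened by subtracting `α` or `ρα`; these two comparisons
  -- bound it.
  have hfar : IsFar c d s ⟨i, j⟩ := by
    unfold IsFar
    dsimp only
    omega
  have hr1 := hfar.rotate
  have hr2 := hr1.rotate
  have hρ : f ejRho ^ 3 = -1 := by rw [← map_pow, ejRho_cube, map_neg, map_one]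
  -- Multiplication by `ρ²` preserves the far triangle modulo `α`, and `ρ³ = -1`. So even `k` stay
  -- in the triangle and odd `k` land in its negative.
  interval_cases k
  · exact ⟨_, hfar, Or.inl (by simp)⟩
  · refine ⟨_, hr2, Or.inr ?_⟩
    simp only [map_neg, map_add, map_mul, map_pow, hα]
    linear_combination (-f ejRho * f ⟨i, j⟩) * hρ
  · refine ⟨_, hr1, Or.inl ?_⟩
    simp only [map_add, map_mul, map_pow, hα]
    ring
  · refine ⟨_, hfar, Or.inr ?_⟩
    simp only [map_neg, map_mul, map_pow]
    linear_combination (-f ⟨i, j⟩) * hρ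
  · refine ⟨_, hr2, Or.inl ?_⟩
    simp only [map_add, map_mul, map_pow, hα]
    ring
  · refine ⟨_, hr1, Or.inr ?_⟩
    simp only [map_neg, map_add, map_mul, map_pow, hα]
    linear_combination (-f ejRho ^ 2 * f ⟨i, j⟩) * hρ

include hf hdc hc hker in
theorem lt_hexLen_of_isFar {s : ℕ} (hs : c + d ≤ 2 * s + 1) {z : EisensteinJacobi}
    (hz : IsFar c d s z) : s < hexLen f (f z) := by
  by_contra! hle
  obtain ⟨w, hw, hfw⟩ := (hexLen_le_iff hf).1 hle
  obtain ⟨q, hq⟩ := (hker (z - w)).1 (by rw [map_sub, hfw, sub_self])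
  obtain rfl : w = z - ⟨c, d⟩ * q := by rw [← hq]; ring
  obtain ⟨x, y⟩ := z
  unfold IsFar at hz
  dsimp only at hz
  by_cases h0 : q = 0
  · rw [h0, mul_zero, sub_zero, hexNorm_mk] at hw
    omega
  obtain ⟨k, hk, i, j, hi, rfl⟩ := exists_sextant h0
  have h1 := le_hexNorm_mul_rotate c d i j k
  have h2 := hexNorm_sub_le ⟨x, y⟩ (⟨x, y⟩ - (⟨c, d⟩ : EisensteinJacobi) * (ejRho ^ k * ⟨i, j⟩))
  rw [sub_sub_cancel] at h2
  -- Hence the multiple of `c + dρ` joining `z` to a representative of norm at most `s` is shorter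
  -- than `2c + d`. This leaves only units as cofactors, that is `i = 1` and `j = 0`.
  have h3 : hexNorm ⟨x, y⟩ + (2 * s + 2) ≤ 2 * c + d := by rw [hexNorm_mk]; omega
  obtain rfl : j = 0 := by
    by_contra hj
    have e1 := Nat.mul_le_mul (le_refl (c + d)) hi
    have e2 := Nat.mul_le_mul (le_refl c) (Nat.one_le_iff_ne_zero.2 hj)
    omega
  obtain rfl : i = 1 := by
    by_contra hi'
    have e1 := Nat.mul_le_mul (le_refl (c + d)) (show 2 ≤ i by omega)
    omega
  have hone : (⟨((1 : ℕ) : ℤ), ((0 : ℕ) : ℤ)⟩ : EisensteinJacobi) = 1 := rfl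
  rw [hone, mul_one, mul_comm] at hw
  interval_cases k
  · rw [pow_zero, one_mul, QuadraticAlgebra.mk_sub_mk, hexNorm_mk] at hw; omega
  · rw [pow_one, ejRho_mul, QuadraticAlgebra.mk_sub_mk, hexNorm_mk] at hw; omega
  · rw [ejRho_sq_mul, QuadraticAlgebra.mk_sub_mk, hexNorm_mk] at hw; omega
  · rw [ejRho_cube_mul, QuadraticAlgebra.mk_sub_mk, hexNorm_mk] at hw; omega
  · rw [ejRho_pow_four_mul, QuadraticAlgebra.mk_sub_mk, hexNorm_mk] at hw; omega
  · rw [ejRho_pow_five_mul, QuadraticAlgebra.mk_sub_mk, hexNorm_mk] at hw; omega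

theorem hexLen_neg (hf : Function.Surjective f) (v : A) : hexLen f (-v) = hexLen f v := by
  rw [← hexLen_pow_mul hf 3 v, ← map_pow, ejRho_cube, map_neg, map_one, neg_one_mul]

-- The far points are the triangle and its negative; `farPoint` coordinates measure the slack in the
-- two upper bounds of `IsFar`.
include hf hdc hc hker in
theorem card_lt_hexLen [Fintype A] {s k : ℕ} (hs : c + d ≤ 2 * s + 1)
    (hk : 3 * s + 2 + k = 2 * c + d) :
    (Finset.univ.filter fun v => s < hexLen f v).card = k * (k + 1) := by
  classical
  have hfp : ∀ x ∈ triangle k, IsFar c d s (farPoint c d s x) := by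
    rintro ⟨p, q⟩ hx
    rw [mem_triangle] at hx
    unfold IsFar farPoint
    dsimp only at *
    omega
  have hinj : ∀ x ∈ triangle k, ∀ y ∈ triangle k,
      f (farPoint c d s x) = f (farPoint c d s y) → x = y := by
    rintro ⟨p, q⟩ hx ⟨p', q'⟩ hy h
    rw [mem_triangle] at hx hy
    dsimp only at hx hy
    have h1 := eq_zero_of_hexNorm_lt hker (z := farPoint c d s ⟨p, q⟩ - farPoint c d s ⟨p', q'⟩)
      (by rw [map_sub, h, sub_self]) (by
        unfold farPoint
        rw [QuadraticAlgebra.mk_sub_mk, hexNorm_mk]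
        dsimp only
        omega)
    unfold farPoint at h1
    rw [sub_eq_zero, QuadraticAlgebra.mk.injEq] at h1
    dsimp only at h1
    obtain rfl : p = p' := by omega
    obtain rfl : q = q' := by omega
    rfl
  have hunion : (Finset.univ.filter fun v => s < hexLen f v) =
      ((triangle k).image fun x => f (farPoint c d s x)) ∪
        ((triangle k).image fun x => f (-farPoint c d s x)) := by
    ext v
    simp only [Finset.mem_filter, Finset.mem_univ, true_and, Finset.mem_union, Finset.mem_image]
    constructor
    · intro hv
      obtain ⟨⟨x, y⟩, hz, h⟩ := exists_isFar hf hdc hc hker hs hv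
      unfold IsFar at hz
      dsimp only at hz
      have hx : (⟨(c - s - 1 - x).toNat, (c + d - s - 1 - y).toNat⟩ : Σ _ : ℕ, ℕ) ∈ triangle k := by
        rw [mem_triangle]; dsimp only; omega
      have he : farPoint c d s ⟨(c - s - 1 - x).toNat, (c + d - s - 1 - y).toNat⟩ = ⟨x, y⟩ := by
        unfold farPoint
        rw [QuadraticAlgebra.mk.injEq]
        dsimp only
        omega
      rcases h with h | h
      · exact Or.inl ⟨_, hx, by rw [he, h]⟩
      · exact Or.inr ⟨_, hx, by rw [he, h]⟩
    · rintro (⟨x, hx, rfl⟩ | ⟨x, hx, rfl⟩)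
      · exact lt_hexLen_of_isFar hf hdc hc hker hs (hfp x hx)
      · rw [map_neg, hexLen_neg hf]
        exact lt_hexLen_of_isFar hf hdc hc hker hs (hfp x hx)
  have hdisj : Disjoint ((triangle k).image fun x => f (farPoint c d s x))
        ((triangle k).image fun x => f (-farPoint c d s x)) := by
    rw [Finset.disjoint_left]
    intro v h1 h2
    obtain ⟨⟨p, q⟩, hx, rfl⟩ := Finset.mem_image.1 h1
    obtain ⟨⟨p', q'⟩, hy, h⟩ := Finset.mem_image.1 h2
    rw [mem_triangle] at hx hy
    dsimp only at hx hy
    -- If `P ≡ -P'`, then `P + P' - α` is a multiple of `α` shorter than `c + d`, so `P + P' = α`.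
    -- But the imaginary parts of far points add up to more than `d`.
    have h3 := eq_zero_of_hexNorm_lt hker
      (z := farPoint c d s ⟨p, q⟩ - -farPoint c d s ⟨p', q'⟩ - ⟨c, d⟩)
      (by rw [map_sub, map_sub, h, sub_self, map_base_eq_zero hker, sub_zero]) (by
        unfold farPoint
        rw [QuadraticAlgebra.neg_mk, QuadraticAlgebra.mk_sub_mk, QuadraticAlgebra.mk_sub_mk,
          hexNorm_mk]
        dsimp only
        omega)
    have h4 := congrArg QuadraticAlgebra.im h3
    unfold farPoint at h4
    rw [QuadraticAlgebra.neg_mk, QuadraticAlgebra.mk_sub_mk, QuadraticAlgebra.mk_sub_mk,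
      QuadraticAlgebra.im_zero] at h4
    dsimp only at h4
    omega
  rw [hunion, Finset.card_union_of_disjoint hdisj, Finset.card_image_of_injOn,
    Finset.card_image_of_injOn]
  · have := two_mul_card_triangle k
    zify
    linear_combination this
  · intro x hx y hy h
    simp only [map_neg, neg_inj] at h
    exact hinj x hx y hy h
  · intro x hx y hy h
    exact hinj x hx y hy h

end Distribution

/-! ### Diameter and sum of the distances -/

section Total

variable {A : Type*} [CommRing A] {f : EisensteinJacobi →+* A} (hf : Function.Surjective f)
  {c d : ℕ} (hdc : d ≤ c) (hc : 1 ≤ c)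
  (hker : ∀ z, f z = 0 ↔ (⟨c, d⟩ : EisensteinJacobi) ∣ z)

include hf hdc hc hker in
theorem hexLen_le_of_lt {D : ℕ} (hD : 2 * c + d < 3 * D + 3) (h2 : c + d ≤ 2 * D + 1) (v : A) :
    hexLen f v ≤ D := by
  by_contra! h
  obtain ⟨z, hz, -⟩ := exists_isFar hf hdc hc hker h2 h
  unfold IsFar at hz
  omega

theorem half_le_of_mod {c d D : ℕ} (hdc : d ≤ c)
    (hD : 2 * c + d = 3 * D + 1 ∨ 2 * c + d = 3 * D + 2) : c + d ≤ 2 * D + 1 := by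
  omega

include hf hdc hc hker in
theorem exists_hexLen_eq [Fintype A] (hcard : Fintype.card A = c ^ 2 + c * d + d ^ 2) {D : ℕ}
    (hD : 2 * c + d = 3 * D + 1 ∨ 2 * c + d = 3 * D + 2) : ∃ v, hexLen f v = D := by
  have hle := hexLen_le_of_lt hf hdc hc hker (D := D) (by omega) (half_le_of_mod hdc hD)
  by_contra! hne
  have hlt : ∀ v, hexLen f v < D := fun v => lt_of_le_of_ne (hle v) (hne v)
  obtain ⟨s, rfl⟩ : ∃ s, D = s + 1 := ⟨D - 1, by have := hlt 0; omega⟩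
  -- In the first case the far triangles at radius `s` are nonempty. In the second the ball of
  -- radius `s` misses points, as `4n ≥ 3(c + d)² ≥ 12(s + 1)²`.
  by_cases hs : c + d ≤ 2 * s + 1
  · have h := card_lt_hexLen hf hdc hc hker (k := 2 * c + d - 3 * s - 2) hs (by omega)
    rw [Finset.filter_false_of_mem (fun v _ => by have := hlt v; omega), Finset.card_empty] at h
    have : 0 < (2 * c + d - 3 * s - 2) * ((2 * c + d - 3 * s - 2) + 1) :=
      Nat.mul_pos (by omega) (by omega)
    omega
  · have h := card_hexLen_le hf hker (s := s) (by omega)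
    rw [Finset.filter_true_of_mem (fun v _ => by have := hlt v; omega), Finset.card_univ, hcard] at h
    have h1 : 2 * s + 2 ≤ c + d := by omega
    nlinarith [Nat.mul_le_mul h1 h1, mul_nonneg (Nat.zero_le c) (Nat.zero_le d),
      sq_nonneg ((c : ℤ) - d)]

/-- The layer-cake formula for a bounded function on a finite type. -/
theorem sum_eq_sum_card_lt {α : Type*} [Fintype α] (g : α → ℕ) (D : ℕ) (h : ∀ v, g v ≤ D) :
    ∑ v, g v = ∑ s ∈ Finset.range D, (Finset.univ.filter fun v => s < g v).card := by
  simp_rw [Finset.card_filter]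
  rw [Finset.sum_comm]
  refine Finset.sum_congr rfl fun v _ => ?_
  rw [← Finset.card_filter, show (Finset.range D).filter (fun s => s < g v) = Finset.range (g v) by
    ext s; simp only [Finset.mem_filter, Finset.mem_range]; have := h v; omega, Finset.card_range]

-- The ball sizes telescope: `3s² + 3s + 1 = (s + 1)³ - s³`.
include hf hker in
theorem sum_card_lt_hexLen_small [Fintype A] (t : ℕ) (ht : 2 * t ≤ c + d + 1) :
    ((∑ s ∈ Finset.range t, (Finset.univ.filter fun v => s < hexLen f v).card : ℕ) : ℤ) =
      Fintype.card A * t - t ^ 3 := by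
  induction t with
  | zero => simp
  | succ t ih =>
    have h1 := card_hexLen_le hf hker (s := t) (by omega)
    have h2 := Finset.card_filter_add_card_filter_not (s := (Finset.univ : Finset A))
      (fun v => hexLen f v ≤ t)
    simp only [not_le] at h2
    rw [h1, Finset.card_univ] at h2
    rw [Finset.sum_range_succ]
    push_cast
    rw [← h2] at ih ⊢
    push_cast at ih ⊢
    rw [ih (by omega)]
    ring

-- With `X = 2c + d - 3s` and `k = X - 2`, the term `9k(k + 1)` is the decrease of `X³ - 3X` as `X`
-- drops to `X - 3`, so the triangle counts telescope too. Here `t` is the radius at which one count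
-- replaces the other.
include hf hdc hc hker in
theorem sum_card_lt_hexLen [Fintype A] {t D : ℕ} (htD : t ≤ D) (ht : 2 * t ≤ c + d + 1)
    (ht' : c + d ≤ 2 * t + 1) (hD : 3 * D + 1 ≤ 2 * c + d) :
    9 * ((∑ s ∈ Finset.range D, (Finset.univ.filter fun v => s < hexLen f v).card : ℕ) : ℤ) =
      9 * (Fintype.card A * t - t ^ 3) + ((2 * c + d - 3 * t) ^ 3 - 3 * (2 * c + d - 3 * t)) -
        ((2 * c + d - 3 * D) ^ 3 - 3 * (2 * c + d - 3 * D))  := by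
  induction D, htD using Nat.le_induction with
  | base => rw [sum_card_lt_hexLen_small hf hker t ht]; ring
  | succ D hDt ih =>
    have h1 := card_lt_hexLen hf hdc hc hker (s := D) (k := 2 * c + d - 3 * D - 2) (by omega)
      (by omega)
    rw [Finset.sum_range_succ, h1]
    obtain ⟨k, hk⟩ : ∃ k, 2 * c + d = 3 * D + 2 + k := ⟨2 * c + d - 3 * D - 2, by omega⟩
    rw [show 2 * c + d - 3 * D - 2 = k by omega]
    have := ih (by omega)
    push_cast at this ⊢
    rw [mul_add, this]
    have hk' : (d : ℤ) = 3 * D + 2 + k - 2 * c := by zify at hk; linarith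
    rw [hk']
    ring

include hf hdc hc hker in
theorem sum_hexLen_eq [Fintype A] {t D : ℕ}
    (hD : 2 * c + d = 3 * D + 1 ∨ 2 * c + d = 3 * D + 2) (ht : 2 * t ≤ c + d + 1)
    (ht' : c + d ≤ 2 * t + 1) (htD : t ≤ D) :
    9 * ((∑ v, hexLen f v : ℕ) : ℤ) =
      9 * (Fintype.card A * t - t ^ 3) + ((2 * c + d - 3 * t) ^ 3 - 3 * (2 * c + d - 3 * t)) -
        ((2 * c + d - 3 * D) ^ 3 - 3 * (2 * c + d - 3 * D)) := by
  rw [sum_eq_sum_card_lt _ D (hexLen_le_of_lt hf hdc hc hker (by omega) (half_le_of_mod hdc hD)),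
    sum_card_lt_hexLen hf hdc hc hker htD ht ht' (by omega)]

include hf hdc hc hker in
theorem sum_hexLen_eq_oddExpression [Fintype A] (hcard : Fintype.card A = c ^ 2 + c * d + d ^ 2)
    {D : ℕ} (hD : 2 * c + d = 3 * D + 1 ∨ 2 * c + d = 3 * D + 2) (hodd : Odd (c + d)) :
    ((∑ v, hexLen f v : ℕ) : ℚ) = 3 * oddExpression c d D := by
  obtain ⟨t, ht⟩ := hodd
  have h := sum_hexLen_eq hf hdc hc hker hD (t := t) (by omega) (by omega) (by omega)
  have h' := congrArg (Int.cast : ℤ → ℚ) h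
  rw [hcard] at h'
  push_cast at h'
  unfold oddExpression
  push_cast
  have e1 : (d : ℚ) = 2 * t + 1 - c := by
    have := congrArg (Nat.cast : ℕ → ℚ) ht
    push_cast at this; linarith
  rcases hD with hD | hD
  · have e2 : (c : ℚ) = 3 * D - 2 * t := by
      have := congrArg (Nat.cast : ℕ → ℚ) hD
      push_cast at this; linarith
    rw [e1, e2] at h' ⊢
    linear_combination h' / 9
  · have e2 : (c : ℚ) = 3 * D + 1 - 2 * t := by
      have := congrArg (Nat.cast : ℕ → ℚ) hD
      push_cast at this; linarith
    rw [e1, e2] at h' ⊢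
    linear_combination h' / 9

include hf hdc hc hker in
theorem sum_hexLen_eq_evenExpression [Fintype A]
    (hcard : Fintype.card A = c ^ 2 + c * d + d ^ 2)
    {D : ℕ} (hD : 2 * c + d = 3 * D + 1 ∨ 2 * c + d = 3 * D + 2) (heven : Even (c + d)) :
    ((∑ v, hexLen f v : ℕ) : ℚ) = 3 * evenExpression (Fintype.card A) c d D := by
  obtain ⟨t, ht⟩ := heven
  have h := sum_hexLen_eq hf hdc hc hker hD (t := t) (by omega) (by omega) (by omega)
  have h' := congrArg (Int.cast : ℤ → ℚ) h
  rw [hcard] at h' ⊢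
  push_cast at h'
  unfold evenExpression
  push_cast
  have e1 : (d : ℚ) = 2 * t - c := by
    have := congrArg (Nat.cast : ℕ → ℚ) ht
    push_cast at this; linarith
  rcases hD with hD | hD
  · have e2 : (c : ℚ) = 3 * D + 1 - 2 * t := by
      have := congrArg (Nat.cast : ℕ → ℚ) hD
      push_cast at this; linarith
    rw [e1, e2] at h' ⊢
    linear_combination h' / 9
  · have e2 : (c : ℚ) = 3 * D + 2 - 2 * t := by
      have := congrArg (Nat.cast : ℕ → ℚ) hD
      push_cast at this; linarith
    rw [e1, e2] at h' ⊢
    linear_combination h' / 9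

end Total

/-! ### The cardinality of `ℤ[ρ] / (c + dρ)` -/

theorem card_ejQuotient (c d : ℕ) (hc : 1 ≤ c) :
    Nat.card (EJQuotient ⟨c, d⟩) = c ^ 2 + c * d + d ^ 2 := by
  have hinj : Function.Injective
      (LinearMap.mulLeft ℤ (⟨c, d⟩ : EisensteinJacobi)) := by
    rw [injective_iff_map_eq_zero]
    intro q hq
    by_contra h0
    have h := le_hexNorm_mul c d h0
    rw [LinearMap.mulLeft_apply] at hq
    rw [hq, hexNorm_zero] at h
    omega
  have hrange : LinearMap.range (LinearMap.mulLeft ℤ (⟨c, d⟩ : EisensteinJacobi)) =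
      (Ideal.span {(⟨c, d⟩ : EisensteinJacobi)}).restrictScalars ℤ := by
    ext z
    simp only [LinearMap.mem_range, LinearMap.mulLeft_apply, Submodule.restrictScalars_mem]
    rw [Ideal.mem_span_singleton]
    exact ⟨fun ⟨q, hq⟩ => ⟨q, hq.symm⟩, fun ⟨q, hq⟩ => ⟨q, hq.symm⟩⟩
  -- The index of the ideal is the absolute determinant of multiplication by its generator, which is
  -- the norm.
  have h1 := Submodule.natAbs_det_equiv _ (LinearEquiv.ofInjective _ hinj)
  rw [show Nat.card (EJQuotient ⟨c, d⟩) = Nat.card (EisensteinJacobi ⧸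
      (Ideal.span {(⟨c, d⟩ : EisensteinJacobi)}).restrictScalars ℤ) from
      (Nat.card_congr (Submodule.Quotient.restrictScalarsEquiv ℤ _).toEquiv).symm, ← hrange, ← h1]
  rw [(show ∀ g g' : EisensteinJacobi →ₗ[ℤ] EisensteinJacobi, g = g' →
      (LinearMap.det g).natAbs = (LinearMap.det g').natAbs from fun _ _ h => by rw [h]) _
      (DistribSMul.toLinearMap ℤ EisensteinJacobi (⟨c, d⟩ : EisensteinJacobi)) (by ext z <;> rfl),
    QuadraticAlgebra.det_toLinearMap_eq_norm, QuadraticAlgebra.norm_def]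
  zify
  rw [abs_of_nonneg]
  · ring
  · have := mul_nonneg (Nat.cast_nonneg (α := ℤ) c) (Nat.cast_nonneg (α := ℤ) d)
    nlinarith [sq_nonneg (c : ℤ), sq_nonneg (d : ℤ)]

/-! ### The diagram -/

theorem ejRho_map_pow_six {A : Type*} [CommRing A] (f : EisensteinJacobi →+* A) :
    f ejRho ^ 6 = 1 := by
  rw [← map_pow, ejRho_pow_six, map_one]

/-- If a nonzero element `w` maps to zero, all distances are less than the norm of `w`. -/
theorem hexLen_lt_of_map_eq_zero {A : Type*} [CommRing A] {f : EisensteinJacobi →+* A}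
    (hf : Function.Surjective f) {w : EisensteinJacobi} (hw : w ≠ 0) (h : f w = 0)
    (v : A) : hexLen f v < hexNorm w := by
  by_contra! hle
  obtain ⟨z, hz, rfl⟩ := exists_hexNorm_eq_hexLen hf v
  obtain ⟨q, hq⟩ := exists_hexNorm_sub_mul_lt hw (hz ▸ hle)
  have := hexLen_map_le hf (z - w * q)
  rw [map_sub, map_mul, h, zero_mul, sub_zero] at this
  omega

theorem mk_natCast_ne_zero {i j : ℕ} (hi : 1 ≤ i) : (⟨i, j⟩ : EisensteinJacobi) ≠ 0 := by
  intro h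
  have := congrArg QuadraticAlgebra.re h
  rw [QuadraticAlgebra.re_zero] at this
  dsimp only at this
  omega

section Cells

variable {n : ℕ} {a : ℤ} {f : EisensteinJacobi →+* ZMod n}
  (hf : Function.Surjective f) (ha : f ejRho = (a : ZMod n))
  (hfree : ∀ (k : ℕ) (u : ZMod n), u ≠ 0 → f ejRho ^ k * u = u → 6 ∣ k)

include ha in
theorem mem_cellOrbit_iff {p : ℕ × ℕ} {u : ZMod n} :
    u ∈ cellOrbit n a p ↔ ∃ k < 6, u = f ejRho ^ k * f ⟨p.1, p.2⟩ := by
  simp only [cellOrbit, Finset.mem_image, Finset.mem_range]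
  refine exists_congr fun k => and_congr_right fun _ => ?_
  rw [mk_eq_add_mul_ejRho, map_add, map_mul, ha, mul_comm, eq_comm]
  simp

include ha in
theorem mem_cellOrbit_of_eq {p : ℕ × ℕ} {u : ZMod n} {k : ℕ}
    (h : u = f ejRho ^ k * f ⟨p.1, p.2⟩) : u ∈ cellOrbit n a p := by
  refine (mem_cellOrbit_iff ha).2 ⟨k % 6, Nat.mod_lt _ (by norm_num), ?_⟩
  rw [h]
  congr 1
  conv_lhs => rw [← Nat.div_add_mod k 6, pow_add, pow_mul, ejRho_map_pow_six, one_pow, one_mul]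

include ha in
theorem mul_mem_cellOrbit {p : ℕ × ℕ} {u : ZMod n} (k : ℕ) (h : u ∈ cellOrbit n a p) :
    f ejRho ^ k * u ∈ cellOrbit n a p := by
  obtain ⟨l, -, rfl⟩ := (mem_cellOrbit_iff ha).1 h
  exact mem_cellOrbit_of_eq ha (k := k + l) (by ring)

include ha in
theorem self_mem_cellOrbit (p : ℕ × ℕ) : f ⟨p.1, p.2⟩ ∈ cellOrbit n a p :=
  mem_cellOrbit_of_eq ha (k := 0) (by simp)

include hf ha in
theorem hexLen_of_mem_cellOrbit {p : ℕ × ℕ} {u : ZMod n} (h : u ∈ cellOrbit n a p) :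
    hexLen f u = hexLen f (f ⟨p.1, p.2⟩) := by
  obtain ⟨l, -, rfl⟩ := (mem_cellOrbit_iff ha).1 h
  exact hexLen_pow_mul hf _ _

include ha in
theorem cellOrbit_subset {p q : ℕ × ℕ} (h : f ⟨p.1, p.2⟩ ∈ cellOrbit n a q) :
    cellOrbit n a p ⊆ cellOrbit n a q := by
  intro u hu
  obtain ⟨l, -, rfl⟩ := (mem_cellOrbit_iff ha).1 hu
  exact mul_mem_cellOrbit ha l h

include ha in
theorem mem_cellOrbit_symm {p q : ℕ × ℕ} {u : ZMod n} (hp : u ∈ cellOrbit n a p)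
    (hq : u ∈ cellOrbit n a q) : f ⟨p.1, p.2⟩ ∈ cellOrbit n a q := by
  obtain ⟨l, hl, rfl⟩ := (mem_cellOrbit_iff ha).1 hp
  have := mul_mem_cellOrbit ha (6 - l) hq
  rwa [← mul_assoc, ← pow_add, Nat.sub_add_cancel hl.le, ejRho_map_pow_six, one_mul] at this

variable (a f) in
/-- The cells selected by the procedure: those at the correct distance from the origin whose orbit
does not meet an earlier cell of the same level. -/
def IsCell (p : ℕ × ℕ) : Prop :=
  1 ≤ p.1 ∧ hexLen f (f ⟨p.1, p.2⟩) = p.1 + p.2 ∧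
    ∀ j < p.2, f ⟨p.1, p.2⟩ ∉ cellOrbit n a (p.1 + p.2 - j, j)

theorem IsCell.ne_zero {p : ℕ × ℕ} (h : IsCell a f p) : f ⟨p.1, p.2⟩ ≠ 0 := by
  intro h0
  have h1 := h.1
  have h2 := h.2.1
  rw [h0, hexLen_zero] at h2
  omega

-- If `(i, j)` is not a cell, its orbit meets that of an earlier pair on the same level; descend on
-- `j`.
include hf ha in
theorem exists_isCell_of_mem (j : ℕ) : ∀ (i : ℕ) (u : ZMod n), 1 ≤ i → hexLen f u = i + j →
    u ∈ cellOrbit n a (i, j) →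
    ∃ q, IsCell a f q ∧ q.2 ≤ j ∧ q.1 + q.2 = i + j ∧ u ∈ cellOrbit n a q := by
  induction j using Nat.strong_induction_on with
  | _ j ih =>
    intro i u hi hu hmem
    by_cases hc : IsCell a f (i, j)
    · exact ⟨_, hc, le_rfl, rfl, hmem⟩
    · have hlen := hexLen_of_mem_cellOrbit hf ha hmem
      have hex : ∃ j' < j, f ⟨i, j⟩ ∈ cellOrbit n a (i + j - j', j') := by
        by_contra! hcon
        exact hc ⟨hi, by rw [← hlen, hu], hcon⟩
      obtain ⟨j', hj', hm⟩ := hex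
      obtain ⟨q, hq, h1, h2, h3⟩ := ih j' hj' (i + j - j') u (by omega) (by omega)
        (cellOrbit_subset ha hm hmem)
      exact ⟨q, hq, by omega, by omega, h3⟩

include hf ha in
theorem exists_isCell {u : ZMod n} (hu : u ≠ 0) :
    ∃ q, IsCell a f q ∧ q.1 + q.2 = hexLen f u ∧ u ∈ cellOrbit n a q := by
  obtain ⟨z, hz, rfl⟩ := exists_hexNorm_eq_hexLen hf u
  obtain ⟨k, hk, i, j, hi, rfl⟩ := exists_sextant (z := z) (by rintro rfl; simp at hu)
  rw [hexNorm_ejRho_pow_mul, hexNorm_natCast_mk] at hz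
  obtain ⟨q, hq, -, h2, h3⟩ := exists_isCell_of_mem hf ha j i _ hi hz.symm
    (mem_cellOrbit_of_eq ha (p := (i, j)) (k := k) (by rw [map_mul, map_pow]))
  exact ⟨q, hq, by omega, h3⟩

theorem mem_coveredBy {Y : Finset (ℕ × ℕ)} {u : ZMod n} :
    u ∈ coveredBy n a Y ↔ ∃ p ∈ Y, u ∈ cellOrbit n a p := by
  rw [coveredBy, Finset.mem_biUnion]

include hf ha in
theorem mem_coveredBy_iff_of_level {Y : Finset (ℕ × ℕ)} {ℓ : ℕ}
    (hY : ∀ p, p ∈ Y ↔ IsCell a f p ∧ p.1 + p.2 ≤ ℓ) {u : ZMod n} (hu : u ≠ 0) :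
    u ∈ coveredBy n a Y ↔ hexLen f u ≤ ℓ := by
  rw [mem_coveredBy]
  constructor
  · rintro ⟨p, hp, hm⟩
    have h := (hY p).1 hp
    rw [hexLen_of_mem_cellOrbit hf ha hm, h.1.2.1]
    exact h.2
  · intro h
    obtain ⟨q, hq, h1, h2⟩ := exists_isCell hf ha hu
    exact ⟨q, (hY q).2 ⟨hq, by omega⟩, h2⟩

-- Loop invariant for one level. The hypothesis `hne` matters because 0 is never covered: a pair of
-- value 0 would be selected although it is not a cell.
include hf ha in
theorem mem_foldl_examineCell {Y : Finset (ℕ × ℕ)} {ℓ : ℕ}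
    (hY : ∀ p, p ∈ Y ↔ IsCell a f p ∧ p.1 + p.2 ≤ ℓ)
    (hne : ∀ i j : ℕ, 1 ≤ i → i + j = ℓ + 1 → f ⟨i, j⟩ ≠ 0) (k : ℕ) (hk : k ≤ ℓ + 1) (p : ℕ × ℕ) :
    p ∈ ((List.range k).map fun j => (ℓ + 1 - j, j)).foldl (examineCell n a) Y ↔
      IsCell a f p ∧ (p.1 + p.2 ≤ ℓ ∨ p.1 + p.2 = ℓ + 1 ∧ p.2 < k) := by
  induction k generalizing p with
  | zero => simp [hY]
  | succ k ih =>
    rw [List.range_succ, List.map_append, List.foldl_append, List.map_singleton, List.foldl_cons,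
      List.foldl_nil]
    set Z := ((List.range k).map fun j => (ℓ + 1 - j, j)).foldl (examineCell n a) Y
    have hZ := ih (by omega)
    have key : cellOrbit n a (ℓ + 1 - k, k) ⊆ coveredBy n a Z ↔
        ¬ IsCell a f (ℓ + 1 - k, k) := by
      constructor
      · intro hsub hcell
        obtain ⟨q, hq, hm⟩ := mem_coveredBy.1 (hsub (self_mem_cellOrbit ha _))
        obtain ⟨hqc, hq2⟩ := (hZ q).1 hq
        have hlen := hexLen_of_mem_cellOrbit hf ha hm
        rw [hcell.2.1, hqc.2.1] at hlen
        dsimp only at hlen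
        refine hcell.2.2 q.2 (by dsimp only; omega) ?_
        dsimp only at hm ⊢
        rwa [show ℓ + 1 - k + k - q.2 = q.1 by omega]
      · intro hcell
        have h0 := hne (ℓ + 1 - k) k (by omega) (by omega)
        have hex : ∃ q ∈ Z, f ⟨(ℓ + 1 - k : ℕ), k⟩ ∈ cellOrbit n a q := by
          have hle := hexLen_map_le hf ⟨(ℓ + 1 - k : ℕ), k⟩
          rw [hexNorm_natCast_mk] at hle
          obtain ⟨q, hqc, hq1, hq2⟩ := exists_isCell hf ha h0
          by_cases hlt : hexLen f (f ⟨(ℓ + 1 - k : ℕ), k⟩) ≤ ℓ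
          · exact ⟨q, (hZ q).2 ⟨hqc, Or.inl (by omega)⟩, hq2⟩
          · have hex : ∃ j' < k, f ⟨(ℓ + 1 - k : ℕ), k⟩ ∈ cellOrbit n a (ℓ + 1 - k + k - j', j') := by
              by_contra! hcon
              exact hcell ⟨by dsimp only; omega, by dsimp only; omega, hcon⟩
            obtain ⟨j', hj', hm⟩ := hex
            obtain ⟨q', hqc', h1, h2, h3⟩ := exists_isCell_of_mem hf ha j' (ℓ + 1 - k + k - j') _
              (by omega) (by omega) hm
            exact ⟨q', (hZ q').2 ⟨hqc', by omega⟩, h3⟩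
        obtain ⟨q, hq, hm⟩ := hex
        intro u hu
        exact mem_coveredBy.2 ⟨q, hq, cellOrbit_subset ha hm hu⟩
    have hp : p = (ℓ + 1 - k, k) ↔ p.1 + p.2 = ℓ + 1 ∧ p.2 = k := by
      rw [Prod.ext_iff]; dsimp only; omega
    unfold examineCell
    by_cases hcell : IsCell a f (ℓ + 1 - k, k)
    · rw [if_neg (fun h => key.1 h hcell), Finset.mem_insert, hZ]
      constructor
      · rintro (rfl | h)
        · exact ⟨hcell, Or.inr (by dsimp only; omega)⟩
        · exact ⟨h.1, by omega⟩
      · rintro ⟨h1, h2⟩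
        by_cases h3 : p = (ℓ + 1 - k, k)
        · exact Or.inl h3
        · exact Or.inr ⟨h1, by rw [hp] at h3; omega⟩
    · rw [if_pos (key.2 hcell), hZ]
      constructor
      · rintro h
        exact ⟨h.1, by omega⟩
      · rintro ⟨h1, h2⟩
        have h3 : p ≠ (ℓ + 1 - k, k) := by rintro rfl; exact hcell h1
        exact ⟨h1, by rw [Ne, hp] at h3; omega⟩

include hf ha in
theorem mem_diagramStage [NeZero n] [Nontrivial (ZMod n)] (m : ℕ) (p : ℕ × ℕ) :
    p ∈ diagramStage n a m ↔ IsCell a f p ∧ p.1 + p.2 ≤ m + 1 := by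
  induction m generalizing p with
  | zero =>
    rw [diagramStage, Finset.mem_singleton]
    constructor
    · rintro rfl
      refine ⟨⟨le_rfl, ?_, by simp⟩, le_rfl⟩
      have h1 := hexLen_map_le hf ⟨(1 : ℕ), (0 : ℕ)⟩
      rw [hexNorm_natCast_mk] at h1
      have h2 : hexLen f (f ⟨(1 : ℕ), (0 : ℕ)⟩) ≠ 0 := by
        intro h
        have h3 := hexLen_eq_zero hf h
        have h4 : (⟨(1 : ℕ), (0 : ℕ)⟩ : EisensteinJacobi) = 1 := rfl
        rw [h4, map_one] at h3
        exact one_ne_zero h3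
      dsimp only
      omega
    · rintro ⟨h, h'⟩
      have := h.1
      exact Prod.ext (by dsimp only; omega) (by dsimp only; omega)
  | succ m ih =>
    rw [diagramStage]
    split_ifs with hcovered
    · rw [ih]
      refine and_congr_right fun hp => ⟨fun h => by omega, fun _ => ?_⟩
      rw [← hp.2.1]
      exact (mem_coveredBy_iff_of_level hf ha ih hp.ne_zero).1 (hcovered _ hp.ne_zero)
    · push Not at hcovered
      obtain ⟨u, hu0, hu⟩ := hcovered
      rw [mem_coveredBy_iff_of_level hf ha ih hu0] at hu
      -- A pair of value 0 on this level would make all distances smaller than the level, so nothing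
      -- would be left uncovered.
      have hne : ∀ i j : ℕ, 1 ≤ i → i + j = m + 1 + 1 → f ⟨i, j⟩ ≠ 0 := by
        intro i j hi hij h0
        have := hexLen_lt_of_map_eq_zero hf (mk_natCast_ne_zero hi) h0 u
        rw [hexNorm_natCast_mk] at this
        omega
      have h := mem_foldl_examineCell hf ha ih hne (m + 1 + 1) le_rfl p
      rw [levelCells]
      refine h.trans (and_congr_right fun hp => ?_)
      have := hp.1
      omega

include hf ha in
theorem mem_diagram [NeZero n] [Nontrivial (ZMod n)] (p : ℕ × ℕ) : p ∈ diagram n a ↔ IsCell a f p := by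
  simp only [diagram, Set.mem_ofPred_eq, mem_diagramStage hf ha]
  exact ⟨fun ⟨_, h⟩ => h.1, fun h => ⟨p.1 + p.2, h, by omega⟩⟩

-- Suppose `(i, j)` is `ρ^k` times an earlier `(i', j')` of its level. Adding 1 to the former adds
-- `ρ^(6-k)` to the latter, and each direction contradicts that `(i + 1, j)` is a cell.
include hf ha hfree in
theorem IsCell.pred {i j : ℕ} (hi : 1 ≤ i) (h : IsCell a f (i + 1, j)) : IsCell a f (i, j) := by
  have h0 := h.ne_zero
  obtain ⟨-, hlen, hnot⟩ := h
  dsimp only at h0 hlen hnot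
  have hadd : f ⟨(i + 1 : ℕ), j⟩ = f ⟨i, j⟩ + 1 := by
    rw [← map_one f, ← map_add]
    congr 1
  have hbound : ∀ (k : ℕ) (w : EisensteinJacobi), f ⟨(i + 1 : ℕ), j⟩ = f ejRho ^ k * f w →
      i + 1 + j ≤ hexNorm w := by
    intro k w hw
    rw [← hlen, hw, hexLen_pow_mul hf]
    exact hexLen_map_le hf w
  refine ⟨hi, le_antisymm ?_ ?_, ?_⟩
  · have := hexLen_map_le hf ⟨i, j⟩
    rwa [hexNorm_natCast_mk] at this
  · have h1 := hexLen_add_le hf (f ⟨i, j⟩) 1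
    have h2 := hexLen_map_le hf 1
    rw [map_one, show hexNorm 1 = 1 from rfl] at h2
    rw [← hadd, hlen] at h1
    dsimp only
    omega
  intro j' hj' hmem
  dsimp only at hj' hmem
  obtain ⟨k, hk, hm⟩ := (mem_cellOrbit_iff ha).1 hmem
  obtain ⟨i', hi'⟩ : ∃ i', i + j = i' + j' := ⟨i + j - j', by omega⟩
  rw [show i + j - j' = i' by omega] at hm
  dsimp only at hm
  have hstep : f ⟨(i + 1 : ℕ), j⟩ = f ejRho ^ k * f (⟨i', j'⟩ + ejRho ^ (6 - k) * ⟨1, 0⟩) := by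
    have h1 : (⟨1, 0⟩ : EisensteinJacobi) = 1 := rfl
    rw [hadd, hm, h1, mul_one, map_add, mul_add, map_pow, ← pow_add, Nat.add_sub_cancel' hk.le,
      ejRho_map_pow_six]
  have hadd_mk : ∀ x y x' y' : ℤ,
      (⟨x, y⟩ + ⟨x', y'⟩ : EisensteinJacobi) = ⟨x + x', y + y'⟩ := fun _ _ _ _ => rfl
  interval_cases k
  · rw [ejRho_pow_six, one_mul, hadd_mk] at hstep
    refine hnot j' hj' (mem_cellOrbit_of_eq ha (k := 0) (hstep.trans ?_))
    congr 3
    · dsimp only; omega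
  -- Adding `ρ⁵` keeps the level when `j' ≥ 1`. When `j' = 0` the relation makes `i` vanish in `ZMod
  -- n`, so `(i + 1, j)` shortens to `(1, j)`.
  · rw [ejRho_pow_five_mul, hadd_mk] at hstep
    by_cases h1 : 1 ≤ j'
    · have := hbound _ _ hstep
      rw [hexNorm_mk] at this
      omega
    · obtain rfl : j' = 0 := by omega
      rw [← map_pow, ← map_mul, pow_one, ejRho_mul] at hstep
      have h2 : f ⟨i, 0⟩ = 0 := by
        have h3 := congrArg (fun x => f ejRho * x) (sub_eq_zero.2 hstep)
        rw [← map_sub, ← map_mul, mul_zero, QuadraticAlgebra.mk_sub_mk, ejRho_mul] at h3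
        rw [← h3]
        congr 2 <;> push_cast <;> omega
      have h3 := hbound 0 (⟨(i + 1 : ℕ), j⟩ - ⟨i, 0⟩) (by
        rw [map_sub, h2, sub_zero, pow_zero, one_mul])
      rw [QuadraticAlgebra.mk_sub_mk, hexNorm_mk] at h3
      omega
  · rw [ejRho_pow_four_mul, hadd_mk] at hstep
    have := hbound _ _ hstep
    rw [hexNorm_mk] at this
    omega
  · rw [ejRho_cube_mul, hadd_mk] at hstep
    have := hbound _ _ hstep
    rw [hexNorm_mk] at this
    omega
  · rw [ejRho_sq_mul, hadd_mk] at hstep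
    have := hbound _ _ hstep
    rw [hexNorm_mk] at this
    omega
  -- Adding `ρ` leads to `(i', j' + 1)`. This is an earlier pair, or `(i + 1, j)` itself, which `ρ⁵`
  -- would then fix against freeness.
  · rw [pow_one, ejRho_mul, hadd_mk] at hstep
    by_cases h1 : j' + 1 < j
    · refine hnot (j' + 1) h1 (mem_cellOrbit_of_eq ha (k := 5) (hstep.trans ?_))
      congr 3
      · dsimp only; omega
    · have h2 : f ⟨(i + 1 : ℕ), j⟩ = f ejRho ^ 5 * f ⟨(i + 1 : ℕ), j⟩ := by
        refine hstep.trans ?_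
        congr 3
        · omega
        · omega
      have := hfree 5 _ h0 h2.symm
      omega

-- By the triangle inequality along `i` and `jρ`, `j` has full length. Thus `j ≤ i_0` for every
-- nonempty column, and a sum up to `r = i_0` misses no cell.
include hf in
theorem IsCell.axis {i j : ℕ} (hj : 1 ≤ j) (h : IsCell a f (i, j)) : IsCell a f (j, 0) := by
  refine ⟨hj, ?_, by simp⟩
  have hlen := h.2.1
  dsimp only at hlen ⊢
  have h1 := hexLen_map_le hf ⟨j, (0 : ℕ)⟩
  rw [hexNorm_natCast_mk] at h1
  have h2 := hexLen_add_le hf (f ⟨i, (0 : ℕ)⟩) (f ejRho ^ 1 * f ⟨j, (0 : ℕ)⟩)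
  have h3 := hexLen_map_le hf ⟨i, (0 : ℕ)⟩
  rw [hexNorm_natCast_mk] at h3
  rw [hexLen_pow_mul hf, pow_one, ← map_mul, ← map_add, ejRho_mul] at h2
  have h4 : (⟨i, (0 : ℕ)⟩ + ⟨-((0 : ℕ) : ℤ), j + (0 : ℕ)⟩ : EisensteinJacobi) = ⟨i, j⟩ := by
    ext <;> simp
  rw [h4, hlen] at h2
  omega

include hf ha hfree in
theorem isCell_iff [NeZero n] [Nontrivial (ZMod n)] {i j : ℕ} :
    IsCell a f (i, j) ↔ 1 ≤ i ∧ i ≤ diagramIndex n a j := by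
  have hset : {i | i = 0 ∨ (i, j) ∈ diagram n a} = {i | i = 0 ∨ IsCell a f (i, j)} := by
    ext i; simp only [Set.mem_ofPred_eq, mem_diagram hf ha]
  -- Without a bound `sSup` on `ℕ` would take its default value 0.
  have hbdd : BddAbove {i | i = 0 ∨ IsCell a f (i, j)} := by
    refine ⟨∑ v, hexLen f v, ?_⟩
    rintro i (rfl | hi)
    · exact Nat.zero_le _
    · have h1 := hi.2.1
      have h2 := Finset.single_le_sum (f := fun v => hexLen f v) (fun v _ => Nat.zero_le _)
        (Finset.mem_univ (f ⟨i, j⟩))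
      dsimp only at h1 h2
      omega
  have hmem := Nat.sSup_mem (s := {i | i = 0 ∨ IsCell a f (i, j)}) ⟨0, Or.inl rfl⟩ hbdd
  rw [diagramIndex, hset]
  constructor
  · intro h
    exact ⟨h.1, le_csSup hbdd (Or.inr h)⟩
  · rintro ⟨h1, h2⟩
    rcases hmem with h | h
    · omega
    · refine Nat.decreasingInduction' (P := fun k => IsCell a f (k, j)) ?_ h2 h
      intro k _ hik hk
      exact hk.pred hf ha hfree (by omega)

include ha hfree in
theorem card_cellOrbit {p : ℕ × ℕ} (h0 : f ⟨p.1, p.2⟩ ≠ 0) : (cellOrbit n a p).card = 6 := by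
  rw [cellOrbit, Finset.card_image_of_injOn, Finset.card_range]
  have hval : (p.1 : ZMod n) + (p.2 : ZMod n) * (a : ZMod n) = f ⟨p.1, p.2⟩ := by
    rw [mk_eq_add_mul_ejRho, map_add, map_mul, ha]; simp
  have key : ∀ k l : ℕ, k ≤ l → l < 6 →
      f ejRho ^ k * f ⟨p.1, p.2⟩ = f ejRho ^ l * f ⟨p.1, p.2⟩ → k = l := by
    intro k l hkl hl h
    have h1 : f ejRho ^ (l - k) * f ⟨p.1, p.2⟩ = f ⟨p.1, p.2⟩ := by
      calc f ejRho ^ (l - k) * f ⟨p.1, p.2⟩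
          = f ejRho ^ (6 - k + l) * f ⟨p.1, p.2⟩ := by
            rw [show 6 - k + l = 6 + (l - k) by omega, pow_add, ejRho_map_pow_six, one_mul]
        _ = f ejRho ^ (6 - k) * (f ejRho ^ k * f ⟨p.1, p.2⟩) := by rw [h, pow_add, mul_assoc]
        _ = f ⟨p.1, p.2⟩ := by
            rw [← mul_assoc, ← pow_add, Nat.sub_add_cancel (by omega), ejRho_map_pow_six, one_mul]
    have := hfree _ _ h0 h1
    omega
  intro k hk l hl h
  simp only [Finset.coe_range, Set.mem_Iio] at hk hl
  dsimp only at h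
  rw [hval, ← ha, mul_comm, mul_comm _ (f ejRho ^ l)] at h
  rcases le_total k l with hkl | hkl
  · exact key k l hkl hl h
  · exact (key l k hkl hk h.symm).symm

include hf ha in
theorem IsCell.eq_of_mem {p q : ℕ × ℕ} (hp : IsCell a f p) (hq : IsCell a f q) {u : ZMod n}
    (hup : u ∈ cellOrbit n a p) (huq : u ∈ cellOrbit n a q) : p = q := by
  have key : ∀ p q : ℕ × ℕ, IsCell a f p → IsCell a f q → u ∈ cellOrbit n a p →
      u ∈ cellOrbit n a q → p.1 + p.2 = q.1 + q.2 → ¬ q.2 < p.2 := by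
    intro p q hp hq hup huq hl hlt
    refine hp.2.2 q.2 hlt ?_
    rw [hl, Nat.add_sub_cancel]
    exact mem_cellOrbit_symm ha hup huq
  have h1 := hexLen_of_mem_cellOrbit hf ha hup
  have h2 := hexLen_of_mem_cellOrbit hf ha huq
  rw [h1, hp.2.1, hq.2.1] at h2
  have h3 := key p q hp hq hup huq h2
  have h4 := key q p hq hp huq hup h2.symm
  exact Prod.ext (by omega) (by omega)

theorem sum_Icc_add (I j : ℕ) : ∑ i ∈ Finset.Icc 1 I, 6 * (i + j) = 3 * (I * (I + 2 * j + 1)) := by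
  induction I with
  | zero => simp
  | succ I ih => rw [Finset.sum_Icc_succ_top (by omega), ih]; ring

include hf ha hfree in
theorem sum_hexLen_eq_diagramExpression [NeZero n] [Nontrivial (ZMod n)] :
    ∑ v, hexLen f v = 3 * diagramExpression n a := by
  set C : Finset (Σ _ : ℕ, ℕ) := (Finset.range (diagramIndex n a 0 + 1)).sigma
    fun j => Finset.Icc 1 (diagramIndex n a j) with hC
  have hmemC : ∀ x, x ∈ C ↔ IsCell a f (x.2, x.1) := by
    rintro ⟨j, i⟩
    rw [isCell_iff hf ha hfree, hC, Finset.mem_sigma, Finset.mem_range, Finset.mem_Icc]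
    refine ⟨fun h => h.2, fun h => ⟨?_, h⟩⟩
    dsimp only at h ⊢
    by_cases hj : 1 ≤ j
    · have h1 := ((isCell_iff hf ha hfree).2 h).axis hf hj
      have h2 := ((isCell_iff hf ha hfree).1 h1).2
      omega
    · omega
  have herase : (Finset.univ : Finset (ZMod n)).erase 0 =
      C.biUnion fun x => cellOrbit n a (x.2, x.1) := by
    ext u
    simp only [Finset.mem_erase, Finset.mem_univ, and_true, Finset.mem_biUnion, hmemC]
    constructor
    · intro hu
      obtain ⟨q, hq, -, hm⟩ := exists_isCell hf ha hu
      exact ⟨⟨q.2, q.1⟩, hq, hm⟩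
    · rintro ⟨x, hx, hm⟩ rfl
      have h1 := hexLen_of_mem_cellOrbit hf ha hm
      have h2 := hx.1
      rw [hx.2.1, hexLen_zero] at h1
      omega
  rw [← Finset.add_sum_erase _ _ (Finset.mem_univ 0), hexLen_zero, zero_add, herase,
    Finset.sum_biUnion]
  · rw [Finset.sum_congr rfl (g := fun x => 6 * (x.2 + x.1)), hC, Finset.sum_sigma]
    · simp_rw [sum_Icc_add]
      rw [diagramExpression, Finset.mul_sum]
    · intro x hx
      have hx' := (hmemC x).1 hx
      rw [Finset.sum_congr rfl (g := fun _ => x.2 + x.1), Finset.sum_const,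
        card_cellOrbit ha hfree hx'.ne_zero, smul_eq_mul]
      intro u hu
      rw [hexLen_of_mem_cellOrbit hf ha hu, hx'.2.1]
  · intro x hx y hy hxy
    refine Finset.disjoint_left.2 fun u hu hv => hxy ?_
    have := IsCell.eq_of_mem hf ha ((hmemC x).1 hx) ((hmemC y).1 hy) hu hv
    rw [Prod.ext_iff] at this
    obtain ⟨x1, x2⟩ := x
    obtain ⟨y1, y2⟩ := y
    dsimp only at this
    obtain ⟨rfl, rfl⟩ := this
    rfl

end Cells

/-! ### Consequences of the Frobenius property -/

theorem ZMod.addAut_apply {n : ℕ} [NeZero n] (h : AddAut (ZMod n)) (x : ZMod n) :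
    h x = h 1 * x := by
  have h1 : x = x.val • (1 : ZMod n) := by simp
  conv_lhs => rw [h1, map_nsmul, nsmul_eq_mul, ZMod.natCast_val, ZMod.cast_id', id, mul_comm]

section Frobenius

variable {n : ℕ} [NeZero n] {S : Set (ZMod n)}

/-- If `1 ∈ S`, multiplication by an element of `S` is an automorphism in a suitable Frobenius
complement, so that `S` is closed under multiplication and acts freely. -/
theorem IsFirstKindFrobeniusSet.mul_mem_and_free (hS : IsFirstKindFrobeniusSet S) (h1 : 1 ∈ S) :
    (∀ x ∈ S, ∀ y ∈ S, x * y ∈ S) ∧ ∀ x ∈ S, ∀ u : ZMod n, u ≠ 0 → x * u = u → x = 1 := by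
  obtain ⟨H, hH, s, rfl, -, -⟩ := hS
  obtain ⟨h0, hh0, hs⟩ := h1
  have key : ∀ x ∈ {x | ∃ h ∈ H, x = h s}, ∃ h ∈ H, ∀ y, h y = x * y := by
    rintro x ⟨h, hh, rfl⟩
    -- The automorphism `h ∘ h0⁻¹` sends `1 = h0 s` to `h s`, hence is multiplication by `h s`.
    refine ⟨h + -h0, H.add_mem hh (H.neg_mem hh0), fun y => ?_⟩
    rw [ZMod.addAut_apply]
    congr 1
    rw [AddAut.add_apply, hs]
    congr 1
    exact h0.symm_apply_apply s
  refine ⟨?_, ?_⟩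
  · rintro x hx y ⟨k, hk, rfl⟩
    obtain ⟨h, hh, hxy⟩ := key x hx
    exact ⟨h + k, H.add_mem hh hk, by rw [AddAut.add_apply, hxy]⟩
  · intro x hx u hu hxu
    obtain ⟨h, hh, hxy⟩ := key x hx
    have hmem : (h.toEquiv : Equiv.Perm (ZMod n)) ∈ semidirectPerm H :=
      ⟨h, hh, 0, fun y => (add_zero _).symm⟩
    have h2 := hH.eq_one_of_fixes_two _ hmem 0 u (Ne.symm hu) (map_zero h) ((hxy u).trans hxu)
    have h3 : h 1 = 1 := congrArg (fun g : Equiv.Perm (ZMod n) => g 1) h2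
    rw [← h3, hxy, mul_one]

end Frobenius

/-! ### Arithmetic of `a` modulo `n` -/

section Circulant

variable {n : ℕ} {a : ℤ}

theorem nodup_of_ncard {α : Type*} {x₁ x₂ x₃ x₄ x₅ x₆ : α}
    (h : ({x₁, x₂, x₃, x₄, x₅, x₆} : Set α).ncard = 6) : [x₁, x₂, x₃, x₄, x₅, x₆].Nodup := by
  classical
  have h1 : ({x₁, x₂, x₃, x₄, x₅, x₆} : Set α) =
      ((↑[x₁, x₂, x₃, x₄, x₅, x₆] : Multiset α).toFinset : Set α) := by
    ext; simp
  rw [h1, Set.ncard_coe_finset] at h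
  exact Multiset.coe_nodup.1 (Multiset.toFinset_card_eq_card_iff_nodup.1 h)

/-- The arithmetic content of the Frobenius hypothesis. -/
theorem IsSixValentFrobeniusCirculant.sq_eq [NeZero n]
    (h : IsSixValentFrobeniusCirculant n a (a - 1) 1) :
    (a : ZMod n) * a = a - 1 ∧ ¬ 3 ∣ n ∧
      ∀ (k : ℕ) (u : ZMod n), u ≠ 0 → (a : ZMod n) ^ k * u = u → 6 ∣ k := by
  obtain ⟨hn, hcard, hS⟩ := h
  have hset : circulantSet n a (a - 1) 1 =
      {(a : ZMod n), -(a : ZMod n), (a : ZMod n) - 1, -((a : ZMod n) - 1), 1, -1} := by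
    simp [circulantSet]
  rw [hset] at hcard hS
  have hnd := nodup_of_ncard hcard
  obtain ⟨hmul, hfix⟩ := hS.mul_mem_and_free (by simp)
  have h5 : (5 : ZMod n) ≠ 0 := by
    intro h
    have h' : ((5 : ℕ) : ZMod n) = 0 := by exact_mod_cast h
    have := Nat.le_of_dvd (by norm_num) ((ZMod.natCast_eq_zero_iff 5 n).1 h')
    omega
  have h01 : (1 : ZMod n) ≠ 0 := by
    intro h
    have h' : ((1 : ℕ) : ZMod n) = 0 := by exact_mod_cast h
    have := Nat.le_of_dvd (by norm_num) ((ZMod.natCast_eq_zero_iff 1 n).1 h')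
    omega
  generalize hb : (a : ZMod n) = b at *
  simp only [List.nodup_cons, List.mem_cons, not_or] at hnd
  obtain ⟨⟨hd1, hd2, hd3, hd4, hd5, -⟩, ⟨hd6, hd7, hd8, hd9, -⟩, ⟨hd10, hd11, hd12, -⟩,
    ⟨hd13, hd14, -⟩, ⟨hd15, -⟩, -⟩ := hnd
  have hmul' : ∀ x y : ZMod n, x ∈ ({b, -b, b - 1, -(b - 1), 1, -1} : Set (ZMod n)) →
      y ∈ ({b, -b, b - 1, -(b - 1), 1, -1} : Set (ZMod n)) →
      x * y = b ∨ x * y = -b ∨ x * y = b - 1 ∨ x * y = -(b - 1) ∨ x * y = 1 ∨ x * y = -1 :=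
    fun x y hx hy => hmul x hx y hy
  have hneg : ∀ u : ZMod n, u = -u → u = 0 := by
    intro u hu
    by_contra h0
    exact hd15 (hfix (-1) (by simp) u h0 (by rw [neg_one_mul]; exact hu.symm)).symm
  have hb0 : b ≠ 0 := by rintro rfl; simp at hd1
  have hb1 : b - 1 ≠ 0 := fun h => hd4 (sub_eq_zero.1 h)
  -- The square of `b` is one of the six elements. Freeness excludes `b`, `-b` and `1`. For `-(b -
  -- 1)` and `-1`, a further product (`b³`, respectively `b(b - 1)`) must also lie in the set, and
  -- each possibility fails.
  have hsq : b * b = b - 1 := by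
    rcases hmul' b b (by simp) (by simp) with h | h | h | h | h | h
    · exact absurd (hfix b (by simp) b hb0 h) hd4
    · refine absurd (hfix (-b) (by simp) b hb0 (by linear_combination -h)) hd8
    · exact h
    · exfalso
      rcases hmul' b (b * b) (by simp) (hmul b (by simp) b (by simp)) with
        h' | h' | h' | h' | h' | h'
      · exact hd4 (by linear_combination h' - (b - 1) * h)
      · have h3 : 3 * b = 1 := by linear_combination h' - (b - 1) * h
        exact h5 (by linear_combination -9 * h + (3 * b + 4) * h3)
      · exact hb0 (by linear_combination h' - (b - 1) * h)
      · have h3 : 3 * b = 2 := by linear_combination h' - (b - 1) * h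
        exact h01 (by linear_combination 9 * h - (3 * b + 5) * h3)
      · exact hb1 (hneg _ (by linear_combination h' - (b - 1) * h))
      · exact hb0 (hneg _ (by linear_combination h' - (b - 1) * h))
    · exact absurd (hfix (-b) (by simp) (b - 1) hb1 (by linear_combination -h)) hd8
    · exfalso
      rcases hmul' b (b - 1) (by simp) (by simp) with h' | h' | h' | h' | h' | h'
      · have h3 : 2 * b = -1 := by linear_combination -h' + h
        exact h5 (by linear_combination 4 * h - (2 * b - 1) * h3)
      · exact h01 (by linear_combination -h' + h)
      · exact hb0 (hneg _ (by linear_combination -h' + h))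
      · exact h01 (hneg _ (by linear_combination -h' + h))
      · have h3 : b = -2 := by linear_combination -h' + h
        exact h5 (by linear_combination h - (b - 2) * h3)
      · exact hb0 (by linear_combination -h' + h)
  refine ⟨hsq, ?_, ?_⟩
  -- If `n = 3m`, then `3 ∣ a² - a + 1` forces `a ≡ 2 (mod 3)`, so `a - 1 ≡ 1 (mod 3)` fixes the
  -- nonzero residue `m`.
  · rintro ⟨m, rfl⟩
    have h1 : ((a * a - a + 1 : ℤ) : ZMod (3 * m)) = 0 := by
      push_cast; rw [hb]; linear_combination hsq
    rw [ZMod.intCast_zmod_eq_zero_iff_dvd] at h1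
    obtain ⟨q, hq⟩ := h1
    have h3 : ∃ r, a = 3 * r + 2 := by
      have h4 : (3 : ℤ) ∣ a * a - a + 1 := ⟨m * q, by rw [hq]; push_cast; ring⟩
      rcases (by omega : a % 3 = 0 ∨ a % 3 = 1 ∨ a % 3 = 2) with h | h | h
      · obtain ⟨r, rfl⟩ : ∃ r, a = 3 * r := ⟨a / 3, by omega⟩
        ring_nf at h4; omega
      · obtain ⟨r, rfl⟩ : ∃ r, a = 3 * r + 1 := ⟨a / 3, by omega⟩
        ring_nf at h4; omega
      · exact ⟨a / 3, by omega⟩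
    obtain ⟨r, rfl⟩ := h3
    have hm0 : (m : ZMod (3 * m)) ≠ 0 := by
      intro h
      have := Nat.le_of_dvd (by omega) ((ZMod.natCast_eq_zero_iff m (3 * m)).1 h)
      omega
    have h3m : (3 : ZMod (3 * m)) * m = 0 := by
      have := ZMod.natCast_self (3 * m)
      exact_mod_cast this
    refine hd11 (hfix (b - 1) (by simp) m hm0 ?_)
    rw [← hb]
    push_cast
    linear_combination (r : ZMod (3 * m)) * h3m
  · intro k u hu hk
    have h3 : b ^ 3 = -1 := by linear_combination (b + 1) * hsq
    have h6 : b ^ 6 = 1 := by linear_combination (b ^ 3 - 1) * h3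
    have hk' : b ^ (k % 6) * u = u := by
      rw [← Nat.div_add_mod k 6, pow_add, pow_mul, h6, one_pow, one_mul] at hk
      exact hk
    have hlt := Nat.mod_lt k (show 6 > 0 by norm_num)
    refine Nat.dvd_of_mod_eq_zero ?_
    -- The powers `b^l` with `0 < l < 6` are the five elements of the set other than 1, so freeness
    -- applies to each.
    generalize k % 6 = l at hk' hlt
    interval_cases l
    · rfl
    · exact absurd (hfix b (by simp) u hu (by linear_combination hk')) hd4
    · exact absurd (hfix (b - 1) (by simp) u hu (by linear_combination hk' - u * hsq)) hd11
    · exact absurd (hfix (-1) (by simp) u hu (by linear_combination hk' - u * h3)).symm hd15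
    · exact absurd (hfix (-b) (by simp) u hu (by linear_combination hk' - u * b * h3)) hd8
    · exact absurd (hfix (-(b - 1)) (by simp) u hu
        (by linear_combination hk' - u * b ^ 2 * h3 + u * hsq)) hd13

end Circulant

/-! ### The evaluation homomorphisms -/

/-- The ring homomorphism sending `ρ` to a root `b` of `x² - x + 1`. -/
def ejEval {A : Type*} [CommRing A] (b : A) (hb : b * b = b - 1) : EisensteinJacobi →+* A where
  toFun z := z.re + z.im * b
  map_one' := by simp [QuadraticAlgebra.re_one, QuadraticAlgebra.im_one]
  map_zero' := by simp
  map_add' z w := by simp; ring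
  map_mul' z w := by
    simp
    linear_combination (-(z.im : A) * w.im) * hb

theorem ejEval_mk {A : Type*} [CommRing A] (b : A) (hb : b * b = b - 1) (x y : ℤ) :
    ejEval b hb ⟨x, y⟩ = x + y * b := rfl

theorem ejEval_ejRho {A : Type*} [CommRing A] (b : A) (hb : b * b = b - 1) :
    ejEval b hb ejRho = b := by
  rw [ejRho, ejEval_mk]; simp

theorem ejEval_surjective {n : ℕ} (b : ZMod n) (hb : b * b = b - 1) :
    Function.Surjective (ejEval b hb) := by
  intro v
  obtain ⟨k, rfl⟩ := ZMod.intCast_surjective v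
  exact ⟨⟨k, 0⟩, by rw [ejEval_mk]; simp⟩

theorem circulantTL_eq_hexGraph {n : ℕ} {a : ℤ} (ha : (a : ZMod n) * a = a - 1) :
    circulantTL n a (a - 1) 1 = hexGraph (ejEval (a : ZMod n) ha) := by
  rw [circulantTL, hexGraph]
  congr 1
  simp only [ejUnits, circulantSet, Set.image_insert_eq, Set.image_singleton, map_neg, map_mul,
    map_one, ejEval_ejRho, sq, ha]
  ext v
  simp only [Set.mem_insert_iff, Set.mem_singleton_iff]
  push_cast
  tauto

/-- The other root `1 - a` of `x² - x + 1` gives the same connection set; using it exchanges the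
coordinates of a kernel generator. -/
theorem circulantTL_eq_hexGraph_conj {n : ℕ} {a : ℤ}
    (ha' : (1 - a : ZMod n) * (1 - a) = (1 - a) - 1) :
    circulantTL n a (a - 1) 1 = hexGraph (ejEval (1 - a : ZMod n) ha') := by
  rw [circulantTL, hexGraph]
  congr 1
  simp only [ejUnits, circulantSet, Set.image_insert_eq, Set.image_singleton, map_neg, map_mul,
    map_one, ejEval_ejRho, sq, ha']
  ext v
  simp only [Set.mem_insert_iff, Set.mem_singleton_iff]
  push_cast
  rw [show (1 - a - 1 : ZMod n) = -a by ring, show (1 - a : ZMod n) = -(a - 1) by ring, neg_neg,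
    neg_neg]
  tauto

/-! ### Generators of kernels -/

section Kernel

variable {A : Type*} [CommRing A] {f : EisensteinJacobi →+* A}

/-- Euclidean descent: any nonzero kernel element is at least as long as `w`, so it can be shortened
by a multiple of `w`. -/
theorem map_eq_zero_iff_dvd_of_minimal {w : EisensteinJacobi} (hw : w ≠ 0) (hfw : f w = 0)
    (hmin : ∀ z, z ≠ 0 → f z = 0 → hexNorm w ≤ hexNorm z) (z : EisensteinJacobi) :
    f z = 0 ↔ w ∣ z := by
  constructor
  · intro hz
    induction hk : hexNorm z using Nat.strong_induction_on generalizing z with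
    | _ k ih =>
      by_cases h0 : z = 0
      · exact h0 ▸ dvd_zero w
      obtain ⟨q, hq⟩ := exists_hexNorm_sub_mul_lt hw (hmin z h0 hz)
      have := ih _ (hk ▸ hq) (z - w * q) (by rw [map_sub, map_mul, hfw, zero_mul, hz, sub_zero]) rfl
      exact (dvd_sub_left (dvd_mul_right w q)).1 this
  · rintro ⟨q, rfl⟩
    rw [map_mul, hfw, zero_mul]

theorem exists_minimal_sextant (h : ∃ z, z ≠ 0 ∧ f z = 0) :
    ∃ i j : ℕ, 1 ≤ i ∧ f ⟨i, j⟩ = 0 ∧ ∀ z, z ≠ 0 → f z = 0 → i + j ≤ hexNorm z := by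
  obtain ⟨w, ⟨hw, hfw⟩, hmin⟩ := WellFounded.has_min (measure hexNorm).wf
    {z | z ≠ 0 ∧ f z = 0} h
  obtain ⟨k, hk, i, j, hi, rfl⟩ := exists_sextant hw
  refine ⟨i, j, hi, ?_, fun z hz hfz => ?_⟩
  · rw [← one_mul (f _), ← ejRho_map_pow_six f, ← Nat.sub_add_cancel hk.le, pow_add, mul_assoc,
      ← map_pow f _ k, ← map_mul, hfw, mul_zero]
  · have : ¬ hexNorm z < hexNorm (ejRho ^ k * ⟨i, j⟩) := hmin z ⟨hz, hfz⟩
    rwa [not_lt, hexNorm_ejRho_pow_mul, hexNorm_natCast_mk] at this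

/-- A surjection with kernel `(α)` identifies its Cayley graph with an Eisenstein-Jacobi graph. -/
theorem nonempty_hexGraph_iso (hf : Function.Surjective f) {α : EisensteinJacobi}
    (hker : ∀ z, f z = 0 ↔ α ∣ z) : Nonempty (hexGraph f ≃g ejGraph α) := by
  have hk : Ideal.span {α} = RingHom.ker f := by
    ext z; rw [Ideal.mem_span_singleton, RingHom.mem_ker, hker]
  let e : EJQuotient α ≃+* A :=
    (Ideal.quotEquivOfEq hk).trans (RingHom.quotientKerEquivOfSurjective hf)
  have he : ∀ z, e (Ideal.Quotient.mk _ z) = f z := fun z => rfl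
  refine ⟨RelIso.symm ⟨e.toEquiv, ?_⟩⟩
  intro u v
  have h1 : ejGraph α = hexGraph (Ideal.Quotient.mk (Ideal.span {α})) := rfl
  rw [h1, hexGraph_adj_iff, hexGraph_adj_iff]
  change e u ≠ e v ∧ (∃ k < 6, e v - e u = _) ↔ _
  simp_rw [← he, ← map_sub, e.injective.eq_iff, e.injective.ne_iff]

end Kernel

/-! ### The main theorem -/

theorem card_eq_of_iso {n c d : ℕ} [NeZero n] {G : SimpleGraph (ZMod n)}
    (e : G ≃g ejGraph ⟨c, d⟩) (hdc : d ≤ c) : 1 ≤ c ∧ n = c ^ 2 + c * d + d ^ 2 := by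
  have hfin : Finite (EJQuotient ⟨c, d⟩) := Finite.of_equiv _ e.toEquiv
  have hc : 1 ≤ c := by
    by_contra! h0
    obtain rfl : c = 0 := by omega
    obtain rfl : d = 0 := by omega
    -- For `c = d = 0` the quotient is `ℤ[ρ]` itself, which is infinite.
    refine not_injective_infinite_finite
      (fun k : ℤ => (Ideal.Quotient.mk _ (k : EisensteinJacobi) : EJQuotient ⟨(0 : ℕ), (0 : ℕ)⟩)) ?_
    intro k l h
    have h1 := Ideal.mem_span_singleton.1 (Ideal.Quotient.eq.1 h)
    have h2 : (⟨((0 : ℕ) : ℤ), ((0 : ℕ) : ℤ)⟩ : EisensteinJacobi) = 0 := rfl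
    rw [h2, zero_dvd_iff, sub_eq_zero] at h1
    exact_mod_cast h1
  refine ⟨hc, ?_⟩
  rw [← card_ejQuotient c d hc, ← Nat.card_congr e.toEquiv, Nat.card_zmod]

theorem coprime_of_kernel {n c d : ℕ} [NeZero n] {f : EisensteinJacobi →+* ZMod n}
    (hker : ∀ z, f z = 0 ↔ (⟨c, d⟩ : EisensteinJacobi) ∣ z)
    (hn : n = c ^ 2 + c * d + d ^ 2) : Nat.Coprime c d := by
  refine Nat.Coprime.symm (Nat.coprime_of_dvd ?_)
  rintro p hp ⟨d', rfl⟩ ⟨c', rfl⟩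
  have hn' : n = p * (p * (c' ^ 2 + c' * d' + d' ^ 2)) := by rw [hn]; ring
  set m := p * (c' ^ 2 + c' * d' + d' ^ 2) with hm
  have h1 : f (m : EisensteinJacobi) = 0 := by
    rw [hker]
    -- The cofactor is the conjugate of `c' + d'ρ`, which makes `m = n / p` a multiple of `c + dρ`.
    -- But `m` is nonzero in `ZMod n`.
    refine ⟨⟨c' + d', -d'⟩, ?_⟩
    rw [QuadraticAlgebra.mk_mul_mk, hm]
    ext
    · rw [QuadraticAlgebra.re_natCast]; push_cast; ring
    · rw [QuadraticAlgebra.im_natCast]; push_cast; ring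
  rw [map_natCast, ZMod.natCast_eq_zero_iff] at h1
  have hn0 := NeZero.pos n
  have hm0 : 0 < m := by
    rcases Nat.eq_zero_or_pos m with h | h
    · rw [h, mul_zero] at hn'; omega
    · exact h
  have h2 := Nat.le_of_dvd hm0 h1
  have h3 := Nat.mul_le_mul hp.two_le (le_refl m)
  omega

theorem exists_iso_ejGraph {n : ℕ} [NeZero n] {a : ℤ} (ha : (a : ZMod n) * a = a - 1) :
    ∃ c d : ℕ, d ≤ c ∧ Nat.Coprime c d ∧
      Nonempty (circulantTL n a (a - 1) 1 ≃g ejGraph ⟨c, d⟩) := by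
  have ha' : (1 - a : ZMod n) * (1 - a) = (1 - a) - 1 := by linear_combination ha
  have key : ∀ (f : EisensteinJacobi →+* ZMod n), Function.Surjective f →
      circulantTL n a (a - 1) 1 = hexGraph f → ∀ i j : ℕ, 1 ≤ i → j ≤ i → f ⟨i, j⟩ = 0 →
      (∀ z, z ≠ 0 → f z = 0 → i + j ≤ hexNorm z) →
      ∃ c d : ℕ, d ≤ c ∧ Nat.Coprime c d ∧
        Nonempty (circulantTL n a (a - 1) 1 ≃g ejGraph ⟨c, d⟩) := by
    intro f hf hG i j hi hji h0 hmin
    have hker := map_eq_zero_iff_dvd_of_minimal (mk_natCast_ne_zero hi) h0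
      (by rwa [hexNorm_natCast_mk])
    obtain ⟨e⟩ := nonempty_hexGraph_iso hf hker
    exact ⟨i, j, hji, coprime_of_kernel hker (card_eq_of_iso e hji).2, hG ▸ ⟨e⟩⟩
  have hn : ∃ z : EisensteinJacobi, z ≠ 0 ∧ ejEval (a : ZMod n) ha z = 0 :=
    ⟨n, Nat.cast_ne_zero.2 (NeZero.ne n), by rw [map_natCast, ZMod.natCast_self]⟩
  obtain ⟨i, j, hi, h0, hmin⟩ := exists_minimal_sextant hn
  rcases le_total j i with hji | hij
  · exact key _ (ejEval_surjective _ _) (circulantTL_eq_hexGraph ha) i j hi hji h0 hmin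
  -- Swapping coordinates preserves `hexNorm` and carries the kernel for `a` to the kernel for `1 -
  -- a`, because `(1 - a)(i + ja) = j + i(1 - a)`.
  · refine key _ (ejEval_surjective _ ha') (circulantTL_eq_hexGraph_conj ha') j i (by omega) hij
      ?_ ?_
    · rw [ejEval_mk] at h0 ⊢
      push_cast at h0 ⊢
      linear_combination (1 - a : ZMod n) * h0 + (j : ZMod n) * ha
    · rintro ⟨x, y⟩ hz hfz
      have h1 := hmin ⟨y, x⟩ (by
        intro h
        rw [QuadraticAlgebra.ext_iff] at h
        exact hz (QuadraticAlgebra.ext h.2 h.1)) (by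
        rw [ejEval_mk] at hfz ⊢
        linear_combination (a : ZMod n) * hfz + (y : ZMod n) * ha)
      rw [hexNorm_mk] at h1 ⊢
      omega

theorem two_mul_wienerIndex_of_iso {n : ℕ} [NeZero n] {A : Type*} [CommRing A] [Fintype A]
    {f : EisensteinJacobi →+* A} (hf : Function.Surjective f) {G : SimpleGraph (ZMod n)}
    (hG : G.Connected) (e : G ≃g hexGraph f) : 2 * wienerIndex G = n * ∑ v : A, hexLen f v := by
  classical
  have hcard : Fintype.card A = n := by
    rw [← Fintype.card_congr e.toEquiv, ZMod.card]
  have h := two_mul_wienerIndex_hexGraph hf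
  rw [hcard] at h
  rw [← h, two_mul_wienerIndex, two_mul_wienerIndex,
    ← e.toEquiv.sum_comp]
  refine Finset.sum_congr rfl fun u _ => ?_
  rw [← e.toEquiv.sum_comp]
  exact Finset.sum_congr rfl fun v _ => (hG.dist_iso_eq e u v).symm

theorem diam_of_iso {n : ℕ} [NeZero n] {A : Type*} [CommRing A]
    {f : EisensteinJacobi →+* A} (hf : Function.Surjective f) {G : SimpleGraph (ZMod n)}
    (hG : G.Connected) (e : G ≃g hexGraph f) {D : ℕ} (hle : ∀ v, hexLen f v ≤ D)
    (hex : ∃ v, hexLen f v = D) : G.diam = D := by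
  obtain ⟨v, hv⟩ := hex
  refine hG.diam_eq (x := e.symm 0) (y := e.symm v) ?_ ?_
  · intro u w
    rw [← hG.dist_iso_eq e, hexGraph_dist_eq hf]
    exact hle _
  · rw [← hG.dist_iso_eq e, hexGraph_dist_eq hf]
    simpa using hv

theorem not_three_dvd_two_mul_add {n c d : ℕ} (hn : n = c ^ 2 + c * d + d ^ 2) (h3 : ¬ 3 ∣ n) :
    ¬ 3 ∣ 2 * c + d := by
  rintro ⟨k, hk⟩
  refine h3 ?_
  have hd : (d : ℤ) = 3 * k - 2 * c := by omega
  zify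
  refine ⟨(c : ℤ) ^ 2 - 3 * k * c + 3 * k ^ 2, ?_⟩
  rw [hn]
  push_cast
  rw [hd]
  ring

theorem mainTheorem10 (n : ℕ) [NeZero n] (a : ℤ)
    (hΓ : IsSixValentFrobeniusCirculant n a (a - 1) 1) :
    (∃ c d : ℕ, d ≤ c ∧ Nat.Coprime c d ∧
      Nonempty (circulantTL n a (a - 1) 1 ≃g ejGraph ⟨(c : ℤ), (d : ℤ)⟩)) ∧
    (∀ c d : ℕ, d ≤ c →
      Nonempty (circulantTL n a (a - 1) 1 ≃g ejGraph ⟨(c : ℤ), (d : ℤ)⟩) →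
      (Odd (c + d) →
        (wienerIndex (circulantTL n a (a - 1) 1) : ℚ) =
          3 * (n : ℚ) / 2 *
            oddExpression c d ((circulantTL n a (a - 1) 1).diam : ℚ)) ∧
      (Even (c + d) →
        (wienerIndex (circulantTL n a (a - 1) 1) : ℚ) =
          3 * (n : ℚ) / 2 *
            evenExpression n c d ((circulantTL n a (a - 1) 1).diam : ℚ))) ∧
    (wienerIndex (circulantTL n a (a - 1) 1) : ℚ) =
      3 * (n : ℚ) / 2 * (diagramExpression n a : ℚ) := by
  obtain ⟨ha, h3, hfree⟩ := hΓ.sq_eq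
  have hf := ejEval_surjective (a : ZMod n) ha
  have hG := circulantTL_eq_hexGraph ha
  have hconn : (circulantTL n a (a - 1) 1).Connected := hG ▸ hexGraph_connected hf
  refine ⟨exists_iso_ejGraph ha, ?_, ?_⟩
  · rintro c d hdc ⟨e⟩
    obtain ⟨hc, hn⟩ := card_eq_of_iso e hdc
    have : Finite (EJQuotient ⟨c, d⟩) := Finite.of_equiv _ e.toEquiv
    have : Fintype (EJQuotient ⟨c, d⟩) := Fintype.ofFinite _
    have hcard : Fintype.card (EJQuotient ⟨c, d⟩) = c ^ 2 + c * d + d ^ 2 := by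
      rw [← Nat.card_eq_fintype_card, card_ejQuotient c d hc]
    -- The graph isomorphism need not respect addition, so the distances are computed in the
    -- quotient ring and only `dist` is transported.
    let g : EisensteinJacobi →+* EJQuotient ⟨c, d⟩ := Ideal.Quotient.mk _
    have hg : Function.Surjective g := Ideal.Quotient.mk_surjective
    have hker : ∀ z, g z = 0 ↔ (⟨c, d⟩ : EisensteinJacobi) ∣ z := fun z =>
      Ideal.Quotient.eq_zero_iff_mem.trans Ideal.mem_span_singleton
    have hD : 2 * c + d = 3 * ((2 * c + d) / 3) + 1 ∨ 2 * c + d = 3 * ((2 * c + d) / 3) + 2 := by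
      have := not_three_dvd_two_mul_add hn h3
      omega
    have hdiam : (circulantTL n a (a - 1) 1).diam = (2 * c + d) / 3 :=
      diam_of_iso hg hconn e
        (hexLen_le_of_lt hg hdc hc hker (by omega) (half_le_of_mod hdc hD))
        (exists_hexLen_eq hg hdc hc hker hcard hD)
    have hW : (2 : ℚ) * wienerIndex (circulantTL n a (a - 1) 1) =
        n * ((∑ v, hexLen g v : ℕ) : ℚ) := by
      exact_mod_cast two_mul_wienerIndex_of_iso hg hconn e
    rw [hdiam]
    refine ⟨fun hodd => ?_, fun heven => ?_⟩
    · rw [sum_hexLen_eq_oddExpression hg hdc hc hker hcard hD hodd] at hW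
      linear_combination hW / 2
    · rw [sum_hexLen_eq_evenExpression hg hdc hc hker hcard hD heven, hcard, ← hn] at hW
      linear_combination hW / 2
  · have : Fact (1 < n) := ⟨by have := hΓ.1; omega⟩
    have h1 := two_mul_wienerIndex_hexGraph hf
    rw [sum_hexLen_eq_diagramExpression hf (ejEval_ejRho _ ha) (by rwa [ejEval_ejRho]), ← hG,
      ZMod.card] at h1
    have h2 : (2 : ℚ) * wienerIndex (circulantTL n a (a - 1) 1) =
        n * (3 * diagramExpression n a) := by exact_mod_cast h1
    linear_combination h2 / 2
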